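/- All graphs are finite and simple. A dissociation set of a graph $G$ is a set of vertices that induces a subgraph in which every vertex has degree at most $1$; it is maximal if it is not a proper subset of another dissociation set. Let $\Phi(G)$ be the number of maximal dissociation sets of $G$. Write $kG$ for the disjoint union of $k$ copies of $G$, $\cup$ for disjoint union, $P_3$ for the path on three vertices and $K_{1,r}$ for the star with $r$ leaves. For $n\ge 4$ with $n\equiv 1\pmod 3$ let $T^*_n$ be the tree of order $n$ obtained from $\frac{n-1}{3}P_3$ and an isolated vertex by joining the isolated vertex to the non-leaf vertex of each of the $\frac{n-1}{3}$ copies of $P_3$. Let $T^*_8$ be the tree of order $8$ obtained from $2K_{1,3}$ by adding an edge between a leaf of one copy and a leaf of the other. Put \[t(n)=3^{\frac{n-1}{3}}+\frac{n-1}{3},\] \[f_1(n)=\begin{cases}3^{\frac n3}, & n\equiv 0\pmod 3,\ n\ge 3,\\ 4\cdot 3^{\frac{n-4}{3}}, & n\equiv 1\pmod 3,\ n\ge 4,\\ 5, & n=5,\\ 4^2\cdot 3^{\frac{n-8}{3}}, & n\equiv 2\pmod 3,\ n\ge 8,\end{cases}\] \[f_2(n)=\begin{cases}3, & n=4,\\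 4, & n=5,\\ 6, & n=6,\\ 11\cdot 3^{\frac{n-7}{3}}, & n\equiv 1\pmod 3,\ n\ge 7,\\ 15\cdot 3^{\frac{n-8}{3}}, & n\equiv 2\pmod 3,\ n\ge 8,\\ 20, & n=9,\\ 4^3\cdot 3^{\frac{n-12}{3}}, & n\equiv 0\pmod 3,\ n\ge 12.\end{cases}\] (1) For every tree $T$ of order $n\ge 4$, $\Phi(T)\le t(n)$, with equality if and only if $n\equiv 1\pmod 3$ and $T\cong T^*_n$. (2) For every forest $F$ of order $n\ge 4$ with $\Phi(F)<f_1(n)$, $\Phi(F)\le f_2(n)$. If moreover $n\ge 7$, then equality holds if and only if \[F\cong\begin{cases}\frac{n-7}{3}P_3\cup T^*_7, & n\equiv 1\pmod 3,\\ \frac{n-8}{3}P_3\cup T^*_8\ \text{ or }\ \frac{n-5}{3}P_3\cup K_{1,4}, & n\equiv 2\pmod 3,\\ K_{1,3}\cup K_{1,4}, & n=9,\\ \frac{n-12}{3}P_3\cup 3K_{1,3}, & n\equiv 0\pmod 3,\ n\ge 12.\end{cases}\] -/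

import Mathlib

/-- A set of vertices is a dissociation set if the subgraph it induces has all degrees at most `1`. -/
def IsDissociationSet {V : Type*} (G : SimpleGraph V) (S : Set V) : Prop :=
  ∀ v : S, ((G.induce S).neighborSet v).encard ≤ 1

/-- `Φ(G)`: the number of (inclusion-wise) maximal dissociation sets of a finite graph. -/
noncomputable def numMaxDissociationSets {V : Type*} (G : SimpleGraph V) : ℕ :=
  {S : Set V | Maximal (IsDissociationSet G) S}.ncard

/-- The disjoint union of `k` copies of `G`. -/
def disjointCopies {V : Type*} (k : ℕ) (G : SimpleGraph V) : SimpleGraph (Fin k × V) where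
  Adj x y := x.1 = y.1 ∧ G.Adj x.2 y.2
  symm := ⟨fun _ _ h => ⟨h.1.symm, h.2.symm⟩⟩
  loopless := ⟨fun _ h => G.irrefl h.2⟩

/-- The path `P₃` on the vertices `0 - 1 - 2`, so that `1` is its non-leaf vertex. -/
abbrev pathP3 : SimpleGraph (Fin 3) := SimpleGraph.pathGraph 3

/-- The star `K_{1,r}`, with centre `Sum.inl 0` and leaves `Sum.inr i`. -/
abbrev starK (r : ℕ) : SimpleGraph (Fin 1 ⊕ Fin r) := completeBipartiteGraph (Fin 1) (Fin r)

/-- The tree `T*_n` (for `n ≥ 4`, `n ≡ 1 mod 3`): the disjoint union of `(n - 1) / 3` copies of `P₃`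
and an isolated vertex `Sum.inr ()`, together with the edges that join the isolated vertex to the
non-leaf vertices of the copies of `P₃`. -/
def treeTStar (n : ℕ) : SimpleGraph ((Fin ((n - 1) / 3) × Fin 3) ⊕ Unit) :=
  (disjointCopies ((n - 1) / 3) pathP3 ⊕g (⊥ : SimpleGraph Unit)) ⊔
    SimpleGraph.fromRel
      (fun x y => ∃ i : Fin ((n - 1) / 3), x = Sum.inl (i, 1) ∧ y = Sum.inr ())

/-- The tree `T*_8`: two disjoint copies of `K_{1,3}`, together with an edge that joins a leaf of the
first copy to a leaf of the second. -/
def treeTStar8 : SimpleGraph ((Fin 1 ⊕ Fin 3) ⊕ (Fin 1 ⊕ Fin 3)) :=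
  (starK 3 ⊕g starK 3) ⊔ SimpleGraph.edge (Sum.inl (Sum.inr 0)) (Sum.inr (Sum.inr 0))

/-- `t(n) = 3 ^ ((n - 1) / 3) + (n - 1) / 3`, with real division and real powers. -/
noncomputable def treeBound (n : ℕ) : ℝ :=
  (3 : ℝ) ^ (((n : ℝ) - 1) / 3) + ((n : ℝ) - 1) / 3

/-- `f₁(n)`, for `n ≥ 3` (the value `0` for `n < 3` is a placeholder). All divisions by `3` are
exact. -/
def forestMax (n : ℕ) : ℕ :=
  if n % 3 = 0 ∧ 3 ≤ n then 3 ^ (n / 3)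
  else if n % 3 = 1 ∧ 4 ≤ n then 4 * 3 ^ ((n - 4) / 3)
  else if n = 5 then 5
  else if n % 3 = 2 ∧ 8 ≤ n then 4 ^ 2 * 3 ^ ((n - 8) / 3)
  else 0

/-- `f₂(n)`, for `n ≥ 4` (the value `0` for `n < 4` is a placeholder). All divisions by `3` are
exact. -/
def forestSecond (n : ℕ) : ℕ :=
  if n = 4 then 3
  else if n = 5 then 4
  else if n = 6 then 6
  else if n % 3 = 1 ∧ 7 ≤ n then 11 * 3 ^ ((n - 7) / 3)
  else if n % 3 = 2 ∧ 8 ≤ n then 15 * 3 ^ ((n - 8) / 3)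
  else if n = 9 then 20
  else if n % 3 = 0 ∧ 12 ≤ n then 4 ^ 3 * 3 ^ ((n - 12) / 3)
  else 0

/-- `F` is, up to isomorphism, one of the extremal forests of order `n ≥ 7` for `f₂(n)`. -/
def IsSecondExtremalForest {V : Type*} (n : ℕ) (F : SimpleGraph V) : Prop :=
  (n % 3 = 1 ∧ Nonempty (F ≃g disjointCopies ((n - 7) / 3) pathP3 ⊕g treeTStar 7)) ∨
  (n % 3 = 2 ∧
    (Nonempty (F ≃g disjointCopies ((n - 8) / 3) pathP3 ⊕g treeTStar8) ∨
      Nonempty (F ≃g disjointCopies ((n - 5) / 3) pathP3 ⊕g starK 4))) ∨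
  (n = 9 ∧ Nonempty (F ≃g starK 3 ⊕g starK 4)) ∨
  (n % 3 = 0 ∧ 12 ≤ n ∧
    Nonempty (F ≃g disjointCopies ((n - 12) / 3) pathP3 ⊕g disjointCopies 3 (starK 3)))

/-! Every tree arises by repeatedly hanging one rooted tree at the root of another, and the number
of maximal dissociation sets can be carried along this construction by six numbers, the `Profile`. A
branch influences the total count only through its profile, and linearly. All profiles lie in the
cone `Tame`, so "branch p counts at most s times as much as branch q, whatever surrounds it" can be
tested on the extreme rays of that cone (`eval_eq`, `dominatedB`).

For trees, the dichotomy is whether some vertex carries two pendant branches of order 3. If none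
does, a finite catalogue of profiles, closed under `attach` up to domination and up to trading three
vertices for a factor 3, bounds the count by 3 ^ ((n - 1) / 3), except for slightly larger values at
a few small orders (`exists_catalogue`). If some vertex does, removing one of the branches and
centring the other divides the count by less than 3 (`count_attach_attach_lt`), so induction
applies. What escapes both arguments are the trees with a vertex whose removal leaves only
components of order 3; their count is 3 ^ k + k minus the number of components attached by an end
vertex (`profile_of_isHub`), which singles out `treeTStar`. The result is `starlike_or_bounded`; the
summand (n - 1) / 3 of `treeBound` leaves room for the exceptional orders.

For forests, the weight Φ ^ 3 / 3 ^ n is multiplicative over components. The path P₃ has weight 1,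
K_{1,3} has 64/81, the tree of order 7 has 1331/2187, K_{1,4} and the tree of order 8 both have
125/243, and every other tree has at most 23/50 (`classify`), less than (64/81) ^ 3. Hence, apart
from copies of P₃, a forest of weight at least (64/81) ^ 3 consists of at most three K_{1,3} or of
one of the three other trees (`isSmall_or`). None, one or two K_{1,3} give the maximum, the
remaining cases are the second extremal forests, and all lighter forests stay below `forestSecond`.
Order 9, where three K_{1,3} do not fit, and orders below 7 are treated by hand. -/

namespace Dissociation

/-! ### Rooted trees and their profiles -/

/-- Rooted trees: `attach x y` joins the root of `y`, as a new child, to the root of `x`. -/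
inductive RTree
  | single : RTree
  | attach : RTree → RTree → RTree
  deriving DecidableEq

namespace RTree

def size : RTree → ℕ
  | single => 1
  | attach x y => x.size + y.size

theorem size_pos : ∀ t : RTree, 0 < t.size
  | single => Nat.one_pos
  | attach x _ => Nat.add_pos_left x.size_pos _

/-- Identify the roots of two rooted trees. -/
def glue (X : RTree) : RTree → RTree
  | single => X
  | attach x y => attach (glue X x) y

theorem size_glue (X t : RTree) : (glue X t).size + 1 = X.size + t.size := by
  induction t with
  | single => rfl
  | attach x y hx _ => simp only [glue, size]; omega

theorem single_glue (t : RTree) : glue single t = t := by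
  induction t with
  | single => rfl
  | attach x y hx _ => simp only [glue, hx]

end RTree

/-- The numbers of vertex sets `S` of a rooted graph in which everything but the root is settled:
`S` induces maximum degree at most `1`, and no vertex outside `S`, other than possibly the root or
its neighbours, can be added. The six cases are: the root is outside `S` and cannot be added
(`blk`); it could be added and has no neighbour in `S` (`bare`), or one neighbour in `S` (`half`);
the root is in `S`, nothing can be added, and the root has no neighbour (`lone`) or one neighbour
(`pair`) in `S`; the root is in `S` without neighbours in `S`, and nothing but neighbours of the
root can be added (`soft`). -/
structure Profile where
  blk : ℕ
  bare : ℕ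
  half : ℕ
  lone : ℕ
  pair : ℕ
  soft : ℕ

namespace Profile

def del (p : Profile) : ℕ := p.blk + p.bare + p.half

def total (p : Profile) : ℕ := p.blk + p.lone + p.pair

def single : Profile := ⟨0, 1, 0, 1, 0, 1⟩

/-- If the root of `p` is outside the set, the part in `q` must be maximal on its own; its root,
when chosen, touches the root of `p`, and blocks it when it already has a neighbour in the set. If
the root of `p` is chosen and the child is not, any child with a chosen neighbour becomes blocked,
and a bare child does only when the root of `p` has a neighbour of its own. If both are chosen, they
form an edge that blocks all neighbours of either, which is what `soft` anticipates. -/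
def attach (p q : Profile) : Profile :=
  ⟨p.blk * q.total + p.bare * q.pair + p.half * (q.lone + q.pair), p.bare * q.blk,
    p.bare * q.lone + p.half * q.blk, p.lone * (q.blk + q.half),
    p.pair * q.del + p.soft * q.soft, p.soft * q.del⟩

/-- Two `half` sides block the common root. If the chosen root has its partner on one side, the
other side only needs to be `soft`, since the partner edge blocks the neighbours of the root there.
-/
def glue (p q : Profile) : Profile :=
  ⟨p.blk * q.del + p.bare * q.blk + p.half * (q.blk + q.half), p.bare * q.bare,
    p.bare * q.half + p.half * q.bare, p.lone * q.lone,
    p.pair * q.soft + p.soft * q.pair, p.soft * q.soft⟩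

theorem ext' {p q : Profile} (h1 : p.blk = q.blk) (h2 : p.bare = q.bare) (h3 : p.half = q.half)
    (h4 : p.lone = q.lone) (h5 : p.pair = q.pair) (h6 : p.soft = q.soft) : p = q := by
  cases p; cases q; simp_all

/-- `eval X p` is the number of maximal dissociation sets after gluing. -/
def eval (X p : Profile) : ℕ := (glue X p).total

theorem glue_attach (X p q : Profile) : glue X (attach p q) = attach (glue X p) q := by
  apply ext' <;> simp only [glue, attach, del, total] <;> ring

theorem glue_attach_left (X p q : Profile) : glue (attach X q) p = glue X (attach p q) := by
  apply ext' <;> simp only [glue, attach, del, total] <;> ring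

theorem glue_single (X : Profile) : glue X single = X := by
  apply ext' <;> simp [glue, single, del]

theorem single_glue (X : Profile) : glue single X = X := by
  apply ext' <;> simp [glue, single]

theorem attach_attach_comm (p q r : Profile) :
    attach (attach p q) r = attach (attach p r) q := by
  apply ext' <;> simp only [attach, del, total] <;> ring

theorem total_attach_comm (p q : Profile) : (attach p q).total = (attach q p).total := by
  simp only [attach, del, total]; ring

theorem eval_attach_left (X p q : Profile) : eval X (attach p q) = eval (attach X q) p := by
  rw [eval, eval, glue_attach_left]

/-- The total does not depend on which end of the joining edge is the root. Seen from the root of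
`q`, all the rest hangs below a single vertex. -/
theorem eval_attach_right (X p q : Profile) :
    eval X (attach p q) = eval (attach single (glue X p)) q := by
  rw [eval, eval, glue_attach_left, single_glue, glue_attach, total_attach_comm]

/-- Inequalities satisfied by the profiles of all rooted trees. -/
structure Tame (p : Profile) : Prop where
  bare_le : p.bare ≤ p.lone
  half_le : p.half ≤ p.pair
  lone_le : p.lone ≤ p.soft
  soft_le : p.soft ≤ p.del

theorem Tame.del_le {p : Profile} (h : p.Tame) : p.del ≤ p.total := by
  have := h.bare_le; have := h.half_le
  simp only [del, total]; omega

theorem tame_single : single.Tame := by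
  constructor <;> decide

theorem del_attach (p q : Profile) : (attach p q).del = p.del * q.total := by
  simp only [attach, del, total]; ring

theorem del_glue (p q : Profile) : (glue p q).del = p.del * q.del := by
  simp only [glue, del]; ring

theorem Tame.attach {p q : Profile} (hp : p.Tame) (hq : q.Tame) : (attach p q).Tame where
  bare_le := Nat.mul_le_mul hp.bare_le (Nat.le_add_right _ _)
  half_le := by
    have h1 : p.bare * q.lone ≤ p.soft * q.soft :=
      Nat.mul_le_mul (hp.bare_le.trans hp.lone_le) hq.lone_le
    have h2 : p.half * q.blk ≤ p.pair * q.del :=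
      Nat.mul_le_mul hp.half_le (by simp only [del]; omega)
    simp only [Profile.attach]; omega
  lone_le := Nat.mul_le_mul hp.lone_le (by simp only [del]; omega)
  soft_le := by
    rw [del_attach]
    exact Nat.mul_le_mul hp.soft_le hq.del_le

theorem Tame.glue {p q : Profile} (hp : p.Tame) (hq : q.Tame) : (glue p q).Tame where
  bare_le := Nat.mul_le_mul hp.bare_le hq.bare_le
  half_le := by
    have h1 : p.bare * q.half ≤ p.soft * q.pair :=
      Nat.mul_le_mul (hp.bare_le.trans hp.lone_le) hq.half_le
    have h2 : p.half * q.bare ≤ p.pair * q.soft :=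
      Nat.mul_le_mul hp.half_le (hq.bare_le.trans hq.lone_le)
    simp only [Profile.glue]; omega
  lone_le := Nat.mul_le_mul hp.lone_le hq.lone_le
  soft_le := by
    rw [del_glue]
    exact Nat.mul_le_mul hp.soft_le hq.soft_le

/-- `p` is dominated by `s` times `q` in every tame surrounding. -/
def Dominated (p : Profile) (s : ℕ) (q : Profile) : Prop :=
  ∀ X : Profile, X.Tame → eval X p ≤ s * eval X q

theorem Dominated.trans {p q r : Profile} {s s' : ℕ} (h : Dominated p s q)
    (h' : Dominated q s' r) : Dominated p (s * s') r := fun X hX =>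
  (h X hX).trans (by rw [mul_assoc]; exact Nat.mul_le_mul_left s (h' X hX))

/-- The two branches are exchanged one after the other, each time counting the other branch as part
of the surrounding, which remains tame. -/
theorem Dominated.attach {p q u v : Profile} {s s' : ℕ} (h : Dominated p s u)
    (h' : Dominated q s' v) (hq : q.Tame) (hu : u.Tame) :
    Dominated (p.attach q) (s * s') (u.attach v) := by
  intro X hX
  rw [eval_attach_left, mul_assoc]
  refine (h _ (hX.attach hq)).trans (Nat.mul_le_mul_left s ?_)
  rw [← eval_attach_left, eval_attach_right, eval_attach_right]
  exact h' _ (tame_single.attach (hX.glue hu))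

theorem Dominated.total {p q : Profile} {s : ℕ} (h : Dominated p s q) :
    p.total ≤ s * q.total := by
  have := h single tame_single
  rwa [eval, eval, single_glue, single_glue] at this

/-- A sufficient criterion for `Dominated`: compare on the extreme rays of the tame cone. -/
def dominatedB (p : Profile) (s : ℕ) (q : Profile) : Bool :=
  Nat.ble p.total (s * q.total) && Nat.ble p.del (s * q.del) &&
  Nat.ble (p.del + p.pair) (s * (q.del + q.pair)) &&
  Nat.ble (p.del + p.pair + p.lone) (s * (q.del + q.pair + q.lone)) &&
  Nat.ble p.soft (s * q.soft) &&
  Nat.ble (p.blk + p.half + p.soft) (s * (q.blk + q.half + q.soft)) &&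
  Nat.ble (p.blk + p.half + p.soft + p.pair) (s * (q.blk + q.half + q.soft + q.pair)) &&
  Nat.ble (p.blk + p.half + p.soft + p.pair + p.lone)
    (s * (q.blk + q.half + q.soft + q.pair + q.lone))

/-- The eight coefficients express `X` as a nonnegative integral combination of generators of the
tame cone; the eight sums are the values of `eval` at these generators. -/
theorem eval_eq (X : Profile) (hX : X.Tame) : ∃ a₀ a₁ a₂ b₀ b₁ b₂ d o : ℕ, ∀ p : Profile,
    eval X p = a₀ * p.del + a₁ * (p.del + p.pair) + a₂ * (p.del + p.pair + p.lone) +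
      b₀ * (p.blk + p.half + p.soft) + b₁ * (p.blk + p.half + p.soft + p.pair) +
      b₂ * (p.blk + p.half + p.soft + p.pair + p.lone) + d * p.soft + o * p.total := by
  obtain ⟨A, B, H, C, D, E⟩ := X
  obtain ⟨h1, h2, h3, h4⟩ := hX
  simp only [del] at h1 h2 h3 h4
  obtain ⟨c, rfl⟩ := Nat.exists_eq_add_of_le h1
  obtain ⟨e, rfl⟩ := Nat.exists_eq_add_of_le h3
  obtain ⟨d, rfl⟩ := Nat.exists_eq_add_of_le h2
  -- After subtracting `B`, the last inequality says c + e ≤ A + H. The demands c and e are met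
  -- greedily from the supplies A and H, so all the parts are natural numbers.
  have key : ∃ c₁ c₂ e₁ e₂ a b : ℕ, c = c₁ + c₂ ∧ e = e₁ + e₂ ∧ A = a + c₁ + e₁ ∧
      H = b + c₂ + e₂ := by
    refine ⟨min c A, c - min c A, min e (A - min c A), e - min e (A - min c A),
      A - min c A - min e (A - min c A),
      H - (c - min c A) - (e - min e (A - min c A)), ?_, ?_, ?_, ?_⟩ <;> omega
  obtain ⟨c₁, c₂, e₁, e₂, a, b, rfl, rfl, rfl, rfl⟩ := key
  refine ⟨a, e₁, c₁, b, e₂, c₂, d, B, fun p => ?_⟩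
  simp only [eval, glue, del, total]
  ring

theorem dominated_of_dominatedB {p q : Profile} {s : ℕ} (h : dominatedB p s q = true) :
    Dominated p s q := by
  intro X hX
  simp only [dominatedB, Bool.and_eq_true, Nat.ble_eq] at h
  obtain ⟨⟨⟨⟨⟨⟨⟨h1, h2⟩, h3⟩, h4⟩, h5⟩, h6⟩, h7⟩, h8⟩ := h
  obtain ⟨a₀, a₁, a₂, b₀, b₁, b₂, d, o, he⟩ := eval_eq X hX
  rw [he, he]
  have e := Nat.mul_le_mul_left a₀ h2
  have e1 := Nat.mul_le_mul_left a₁ h3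
  have e2 := Nat.mul_le_mul_left a₂ h4
  have e3 := Nat.mul_le_mul_left b₀ h6
  have e4 := Nat.mul_le_mul_left b₁ h7
  have e5 := Nat.mul_le_mul_left b₂ h8
  have e6 := Nat.mul_le_mul_left d h5
  have e7 := Nat.mul_le_mul_left o h1
  calc _ ≤ _ := add_le_add (add_le_add (add_le_add (add_le_add (add_le_add (add_le_add
        (add_le_add e e1) e2) e3) e4) e5) e6) e7
    _ = _ := by ring

end Profile

/-! ### Profiles and counts of rooted trees -/

namespace RTree

def profile : RTree → Profile
  | single => Profile.single
  | attach x y => (profile x).attach (profile y)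

theorem tame_profile : ∀ t : RTree, t.profile.Tame
  | single => Profile.tame_single
  | attach x y => (tame_profile x).attach (tame_profile y)

theorem profile_glue (X t : RTree) : (glue X t).profile = X.profile.glue t.profile := by
  induction t with
  | single => exact (Profile.glue_single _).symm
  | attach x y hx _ => rw [glue, profile, hx, profile, Profile.glue_attach]

/-- The number of maximal dissociation sets, computed recursively. -/
def count (t : RTree) : ℕ := t.profile.total

/-- Positivity of `soft` provides the strict gain in `count_attach_attach_lt`. -/
theorem soft_pos (t : RTree) : 0 < t.profile.soft ∧ 0 < t.profile.del := by
  induction t with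
  | single => decide
  | attach x y hx hy =>
    refine ⟨Nat.mul_pos hx.1 hy.2, ?_⟩
    rw [profile, Profile.del_attach]
    exact Nat.mul_pos hx.2 (hy.2.trans_le y.tame_profile.del_le)

end RTree
end Dissociation

namespace Dissociation
open Profile

/-! ### Rooted trees without two pendant paths `P₃` at a common vertex -/

namespace RTree

/-- Some child of the root spans a subtree of order `3`. -/
def hasTriple : RTree → Bool
  | single => false
  | attach x y => hasTriple x || y.size == 3

/-- Some vertex has two children that span subtrees of order `3`. -/
def twinTriple : RTree → Bool
  | single => false
  | attach x y => twinTriple x || twinTriple y || (hasTriple x && y.size == 3)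

end RTree

/-- Profiles, by order of the tree, that dominate all rooted trees without twin triples. The flag
records, for orders at most `12`, whether the root may have a child of order `3`. -/
def catalogue : List (ℕ × List (Bool × Profile)) :=
  [(21, [(false, ⟨912, 32, 80, 32, 405, 243⟩)]),
    (20, [(false, ⟨321, 0, 108, 0, 588, 332⟩)]),
    (19, [(false, ⟨81, 108, 240, 124, 256, 332⟩)]),
    (18, [(false, ⟨79, 143, 110, 143, 110, 226⟩), (false, ⟨168, 88, 60, 112, 145, 192⟩), (false, ⟨108,
      208, 16, 240, 81, 256⟩), (false, ⟨91, 185, 56, 193, 64, 237⟩), (false, ⟨99, 160, 40, 204,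
      108, 240⟩), (false, ⟨116, 130, 52, 188, 105, 220⟩), (false, ⟨110, 79, 99, 162, 126, 226⟩),
      (false, ⟨81, 114, 72, 168, 135, 236⟩), (false, ⟨91, 121, 54, 182, 120, 236⟩)]),
    (17, [(false, ⟨208, 16, 32, 16, 108, 81⟩), (false, ⟨160, 36, 44, 40, 99, 108⟩), (false, ⟨114, 68,
      54, 72, 81, 135⟩), (false, ⟨121, 54, 61, 54, 91, 120⟩), (false, ⟨79, 64, 83, 99, 110, 126⟩),
      (false, ⟨185, 44, 8, 56, 91, 64⟩), (false, ⟨108, 80, 48, 88, 75, 144⟩), (false, ⟨130, 32,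
      58, 52, 116, 105⟩), (false, ⟨143, 83, 0, 110, 79, 110⟩), (false, ⟨54, 66, 96, 86, 108, 152⟩)]),
    (16, [(false, ⟨66, 66, 20, 96, 54, 108⟩), (false, ⟨64, 27, 35, 83, 79, 110⟩), (false, ⟨83, 0, 27,
      0, 143, 79⟩)]),
    (15, [(false, ⟨66, 12, 30, 20, 66, 54⟩), (false, ⟨112, 8, 12, 8, 36, 18⟩), (false, ⟨27, 27, 56,
      35, 64, 79⟩), (false, ⟨53, 0, 15, 0, 107, 59⟩), (false, ⟨35, 27, 39, 53, 55, 71⟩), (false,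
      ⟨89, 15, 16, 15, 43, 27⟩), (false, ⟨87, 29, 4, 29, 37, 33⟩), (false, ⟨43, 40, 24, 56, 48,
      72⟩), (false, ⟨44, 8, 20, 24, 84, 64⟩), (false, ⟨59, 0, 0, 0, 105, 48⟩), (false, ⟨73, 16,
      32, 16, 48, 36⟩), (false, ⟨36, 21, 42, 41, 60, 70⟩), (false, ⟨51, 36, 12, 60, 45, 68⟩),
      (false, ⟨96, 15, 15, 15, 36, 21⟩), (false, ⟨89, 16, 16, 16, 34, 24⟩), (false, ⟨95, 12, 13,
      18, 38, 21⟩), (false, ⟨90, 13, 14, 17, 42, 26⟩), (false, ⟨88, 25, 4, 29, 39, 33⟩), (false,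
      ⟨74, 12, 24, 20, 48, 36⟩), (false, ⟨72, 35, 0, 45, 39, 45⟩), (false, ⟨44, 18, 26, 54, 50,
      72⟩), (false, ⟨35, 0, 44, 0, 91, 64⟩), (false, ⟨45, 0, 34, 0, 82, 55⟩), (false, ⟨53, 0, 18,
      0, 90, 55⟩), (false, ⟨41, 0, 29, 0, 96, 60⟩), (false, ⟨46, 4, 18, 12, 93, 60⟩), (false, ⟨33,
      39, 39, 39, 39, 53⟩), (false, ⟨72, 39, 0, 39, 33, 39⟩), (false, ⟨70, 40, 0, 40, 33, 40⟩),
      (false, ⟨54, 56, 0, 64, 27, 64⟩), (false, ⟨25, 69, 16, 69, 16, 81⟩), (false, ⟨34, 63, 10,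
      75, 18, 81⟩), (false, ⟨62, 39, 0, 55, 35, 55⟩), (false, ⟨33, 52, 12, 68, 36, 80⟩), (false,
      ⟨40, 18, 28, 52, 53, 70⟩), (false, ⟨45, 12, 25, 48, 59, 63⟩), (false, ⟨57, 25, 0, 59, 45,
      59⟩), (false, ⟨27, 18, 34, 45, 55, 79⟩), (false, ⟨48, 9, 19, 53, 59, 68⟩), (false, ⟨57, 19,
      0, 59, 48, 59⟩)]),
    (14, [(false, ⟨63, 6, 12, 10, 34, 18⟩), (false, ⟨52, 12, 16, 12, 33, 36⟩), (false, ⟨40, 16, 16,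
      24, 43, 48⟩), (false, ⟨18, 18, 36, 26, 44, 50⟩), (false, ⟨36, 8, 24, 12, 51, 45⟩), (false,
      ⟨27, 44, 8, 56, 27, 64⟩), (false, ⟨27, 18, 26, 39, 35, 55⟩), (false, ⟨56, 0, 8, 0, 54, 27⟩),
      (false, ⟨69, 12, 0, 16, 25, 16⟩), (false, ⟨25, 0, 34, 0, 57, 45⟩), (false, ⟨19, 0, 40, 0,
      57, 48⟩), (false, ⟨17, 15, 27, 32, 40, 59⟩), (false, ⟨39, 0, 16, 0, 62, 35⟩), (false, ⟨35,
      0, 10, 0, 72, 39⟩), (false, ⟨33, 0, 7, 0, 73, 40⟩), (false, ⟨40, 0, 0, 0, 70, 33⟩), (false,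
      ⟨39, 0, 0, 0, 72, 33⟩), (false, ⟨18, 34, 27, 34, 27, 55⟩), (false, ⟨18, 18, 34, 28, 40,
      53⟩), (false, ⟨21, 29, 20, 42, 36, 60⟩), (false, ⟨9, 15, 44, 19, 48, 59⟩), (false, ⟨26, 16,
      26, 33, 39, 45⟩), (false, ⟨12, 15, 36, 25, 45, 59⟩), (false, ⟨39, 14, 0, 39, 33, 39⟩)]),
    (13, [(false, ⟨44, 8, 12, 8, 27, 27⟩), (false, ⟨29, 18, 13, 20, 21, 36⟩), (false, ⟨15, 27, 17, 27,
      17, 40⟩), (false, ⟨15, 34, 10, 36, 12, 45⟩), (false, ⟨31, 14, 15, 14, 22, 30⟩), (false, ⟨18,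
      16, 21, 26, 27, 35⟩), (false, ⟨6, 10, 29, 14, 33, 39⟩), (false, ⟨30, 8, 14, 14, 28, 30⟩),
      (false, ⟨17, 15, 18, 28, 21, 40⟩), (false, ⟨11, 0, 29, 0, 37, 33⟩), (false, ⟨14, 0, 25, 0,
      39, 33⟩), (false, ⟨16, 25, 18, 25, 18, 35⟩), (false, ⟨15, 40, 4, 44, 9, 48⟩), (false, ⟨34,
      21, 0, 27, 18, 27⟩), (false, ⟨16, 24, 15, 28, 16, 39⟩), (false, ⟨12, 27, 15, 27, 15, 42⟩),
      (false, ⟨18, 25, 10, 34, 18, 40⟩), (false, ⟨12, 16, 22, 22, 24, 39⟩), (false, ⟨18, 24, 8,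
      36, 18, 44⟩), (false, ⟨17, 13, 19, 26, 25, 36⟩), (false, ⟨16, 12, 17, 26, 26, 39⟩), (false,
      ⟨15, 12, 15, 27, 21, 42⟩), (false, ⟨4, 7, 29, 11, 33, 40⟩), (false, ⟨16, 9, 15, 25, 27, 40⟩)]),
    (12, [(false, ⟨24, 8, 12, 8, 18, 18⟩), (false, ⟨16, 9, 10, 21, 18, 27⟩), (false, ⟨25, 6, 9, 10,
      18, 18⟩), (false, ⟨21, 0, 6, 0, 34, 18⟩), (true, ⟨40, 4, 4, 4, 15, 9⟩), (true, ⟨34, 9, 2,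
      10, 15, 12⟩), (false, ⟨32, 8, 4, 8, 13, 12⟩), (false, ⟨17, 0, 4, 0, 35, 19⟩), (false, ⟨18,
      0, 0, 0, 41, 16⟩), (false, ⟨31, 6, 3, 8, 16, 12⟩), (false, ⟨13, 0, 9, 0, 32, 20⟩), (false,
      ⟨12, 15, 15, 15, 15, 21⟩), (false, ⟨27, 15, 0, 15, 12, 15⟩), (false, ⟨15, 12, 13, 18, 17,
      21⟩), (false, ⟨9, 15, 16, 15, 16, 27⟩), (false, ⟨27, 13, 0, 17, 15, 17⟩), (false, ⟨7, 29, 4,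
      29, 4, 33⟩), (false, ⟨12, 13, 14, 17, 16, 26⟩), (false, ⟨24, 11, 4, 15, 16, 16⟩), (false,
      ⟨16, 17, 6, 22, 12, 24⟩), (false, ⟨10, 25, 4, 29, 6, 33⟩), (false, ⟨13, 10, 13, 19, 17,
      25⟩), (false, ⟨25, 10, 0, 18, 16, 18⟩)]),
    (11, [(false, ⟨9, 6, 12, 10, 16, 18⟩), (false, ⟨13, 0, 4, 0, 27, 15⟩), (true, ⟨25, 4, 4, 4, 10,
      6⟩), (false, ⟨17, 2, 5, 6, 16, 12⟩), (true, ⟨29, 4, 0, 4, 7, 4⟩), (false, ⟨15, 12, 0, 16, 9,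
      16⟩), (false, ⟨10, 6, 9, 13, 13, 17⟩), (false, ⟨10, 0, 8, 0, 25, 16⟩), (false, ⟨15, 0, 0, 0,
      27, 12⟩), (false, ⟨13, 9, 4, 14, 12, 16⟩), (false, ⟨5, 14, 5, 14, 5, 19⟩), (false, ⟨5, 16,
      3, 17, 4, 20⟩), (false, ⟨7, 9, 6, 14, 12, 20⟩), (false, ⟨3, 4, 14, 6, 16, 19⟩), (false, ⟨12,
      3, 6, 13, 15, 17⟩), (false, ⟨4, 5, 12, 8, 15, 19⟩), (false, ⟨15, 6, 0, 15, 12, 15⟩), (false,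
      ⟨5, 5, 9, 10, 13, 19⟩), (false, ⟨11, 1, 4, 4, 24, 16⟩)]),
    (10, [(false, ⟨9, 6, 5, 6, 7, 12⟩), (false, ⟨6, 8, 4, 12, 9, 16⟩), (false, ⟨9, 2, 5, 4, 13, 12⟩),
      (false, ⟨16, 3, 1, 3, 5, 4⟩), (false, ⟨5, 11, 3, 12, 4, 15⟩), (false, ⟨12, 0, 4, 0, 15, 9⟩),
      (false, ⟨6, 0, 9, 0, 15, 12⟩), (false, ⟨4, 4, 7, 8, 10, 15⟩), (false, ⟨7, 0, 7, 0, 15, 11⟩),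
      (false, ⟨5, 9, 5, 9, 5, 13⟩), (false, ⟨14, 5, 0, 5, 5, 5⟩), (false, ⟨4, 13, 2, 14, 3, 16⟩),
      (false, ⟨3, 4, 10, 6, 12, 15⟩), (false, ⟨6, 4, 7, 8, 11, 11⟩), (false, ⟨6, 4, 7, 9, 10, 13⟩)]),
    (9, [(false, ⟨8, 4, 4, 4, 6, 9⟩), (false, ⟨5, 0, 0, 0, 14, 5⟩), (false, ⟨13, 2, 1, 2, 4, 3⟩),
      (true, ⟨11, 3, 1, 3, 5, 4⟩), (false, ⟨4, 7, 4, 7, 4, 10⟩), (false, ⟨11, 4, 0, 4, 4, 4⟩),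
      (false, ⟨4, 9, 2, 10, 3, 12⟩), (false, ⟨3, 7, 4, 7, 4, 11⟩), (false, ⟨4, 4, 5, 7, 6, 10⟩),
      (false, ⟨9, 4, 0, 5, 5, 5⟩), (false, ⟨4, 3, 4, 7, 6, 11⟩)]),
    (8, [(false, ⟨3, 4, 4, 4, 4, 6⟩), (false, ⟨5, 0, 0, 0, 9, 4⟩), (true, ⟨9, 2, 1, 2, 4, 3⟩),
      (false, ⟨4, 3, 3, 5, 4, 6⟩), (false, ⟨5, 0, 1, 0, 8, 4⟩), (false, ⟨4, 0, 1, 0, 9, 5⟩),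
      (false, ⟨4, 0, 0, 0, 11, 4⟩), (false, ⟨7, 4, 0, 4, 3, 4⟩), (false, ⟨7, 3, 0, 4, 4, 4⟩),
      (false, ⟨5, 2, 0, 5, 4, 5⟩)]),
    (7, [(false, ⟨3, 1, 2, 3, 4, 4⟩), (false, ⟨2, 0, 3, 0, 5, 4⟩), (false, ⟨4, 0, 0, 0, 7, 3⟩),
      (false, ⟨3, 0, 1, 0, 7, 4⟩), (false, ⟨4, 2, 0, 4, 3, 4⟩), (false, ⟨1, 4, 1, 4, 1, 5⟩),
      (false, ⟨1, 1, 3, 2, 4, 5⟩)]),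
    (6, [(false, ⟨2, 0, 2, 0, 4, 3⟩), (false, ⟨1, 3, 1, 3, 1, 4⟩), (false, ⟨4, 1, 0, 1, 1, 1⟩),
      (false, ⟨1, 1, 2, 2, 3, 4⟩)]),
    (5, [(false, ⟨1, 2, 1, 2, 1, 3⟩), (false, ⟨3, 1, 0, 1, 1, 1⟩), (false, ⟨1, 0, 0, 0, 4, 1⟩)]),
    (4, [(false, ⟨1, 0, 0, 0, 3, 1⟩), (true, ⟨2, 1, 0, 1, 1, 1⟩)]),
    (3, [(false, ⟨1, 0, 0, 0, 2, 1⟩)]),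
    (2, [(false, ⟨0, 0, 1, 0, 1, 1⟩)]),
    (1, [(false, ⟨0, 1, 0, 1, 0, 1⟩)])]

/-- Is a profile for order `n` and flag `f` dominated by a catalogue entry? -/
def catalogued (n : ℕ) (f : Bool) (p : Profile) : Bool :=
  catalogue.any fun l =>
    Nat.ble l.1 n && Nat.beq ((n - l.1) % 3) 0 && (Nat.beq l.1 n || Nat.ble 13 l.1) &&
      l.2.any fun e =>
        (Nat.ble 13 l.1 || !e.1 || f) && p.dominatedB (3 ^ ((n - l.1) / 3)) e.2

/-- The pairs that are let off are those in which a root known to have a child of order 3 would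
receive a second one. Without this exclusion the three-cherry growth of the starlike trees would
have to be dominated too. -/
def catalogueClosed : Bool :=
  catalogue.all fun l => catalogue.all fun m => l.2.all fun e => m.2.all fun e' =>
    (Nat.ble l.1 12 && e.1 && Nat.beq m.1 3) ||
      catalogued (l.1 + m.1) (e.1 || Nat.beq m.1 3) (e.2.attach e'.2)

set_option maxRecDepth 100000 in
theorem catalogueClosed_eq : catalogueClosed = true := by decide +kernel
end Dissociation

namespace Dissociation
open Profile

/-! ### Domination of all trees without twin triples by the catalogue -/

theorem catalogued_iff {n : ℕ} {f : Bool} {p : Profile} (h : catalogued n f p = true) :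
    ∃ l ∈ catalogue, ∃ e ∈ l.2, ∃ j, n = l.1 + 3 * j ∧ (j ≠ 0 → 13 ≤ l.1) ∧
      (l.1 ≤ 12 → e.1 = true → f = true) ∧ Dominated p (3 ^ j) e.2 := by
  simp only [catalogued, List.any_eq_true, Bool.and_eq_true, Bool.or_eq_true, Nat.ble_eq,
    Nat.beq_eq, Bool.not_eq_true'] at h
  obtain ⟨l, hl, ⟨⟨h1, h2⟩, h3⟩, e, he, h4, h5⟩ := h
  refine ⟨l, hl, e, he, (n - l.1) / 3, by omega, by omega, fun hl' het => ?_,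
    dominated_of_dominatedB h5⟩
  rcases h4 with (h4 | h4) | h4
  · omega
  · rw [het] at h4; cases h4
  · exact h4

/-- The cubic bound is invariant under adding three vertices and multiplying the total by 3, so from
order 13 on it passes to every order reached by such shifts. Orders below 10 serve only as building
blocks and get no bound. -/
def catalogueSound : Bool :=
  catalogue.all fun l => l.2.all fun e =>
    decide (e.2.bare ≤ e.2.lone ∧ e.2.half ≤ e.2.pair ∧ e.2.lone ≤ e.2.soft ∧
      e.2.soft ≤ e.2.del ∧ (l.1 = 10 → e.2.total ≤ 27) ∧ (l.1 = 11 → e.2.total ≤ 42) ∧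
      (l.1 = 12 → e.2.total ≤ 59) ∧ (13 ≤ l.1 → e.2.total ^ 3 ≤ 3 ^ (l.1 - 1)))

theorem catalogueSound_eq : catalogueSound = true := by decide +kernel

theorem catalogue_spec {l : ℕ × List (Bool × Profile)} (hl : l ∈ catalogue) {e : Bool × Profile}
    (he : e ∈ l.2) : e.2.Tame ∧ (l.1 = 10 → e.2.total ≤ 27) ∧ (l.1 = 11 → e.2.total ≤ 42) ∧
      (l.1 = 12 → e.2.total ≤ 59) ∧ (13 ≤ l.1 → e.2.total ^ 3 ≤ 3 ^ (l.1 - 1)) := by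
  have h := catalogueSound_eq
  simp only [catalogueSound, List.all_eq_true, decide_eq_true_eq] at h
  obtain ⟨h1, h2, h3, h4, h5⟩ := h l hl e he
  exact ⟨⟨h1, h2, h3, h4⟩, h5⟩

namespace RTree

/-- Both branches are replaced by catalogue entries, whose join is again dominated by an entry; the
exponents of 3 add up. A flagged entry is only ever used for a tree whose root really has a child of
order 3. -/
theorem exists_catalogue (t : RTree) (ht : t.twinTriple = false) :
    ∃ l ∈ catalogue, ∃ e ∈ l.2, ∃ j, t.size = l.1 + 3 * j ∧ (j ≠ 0 → 13 ≤ l.1) ∧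
      (l.1 ≤ 12 → e.1 = true → t.hasTriple = true) ∧ Dominated t.profile (3 ^ j) e.2 := by
  induction t with
  | single =>
    have h : catalogued 1 false Profile.single = true := by decide +kernel
    exact catalogued_iff h
  | attach x y hx hy =>
    simp only [twinTriple, Bool.or_eq_false_iff] at ht
    obtain ⟨⟨htx, hty⟩, htxy⟩ := ht
    obtain ⟨l, hl, e, he, i, hi, hi', hfi, hdi⟩ := hx htx
    obtain ⟨m, hm, d, hd, k, hk, hk', hfk, hdk⟩ := hy hty
    have hc := catalogueClosed_eq
    simp only [catalogueClosed, List.all_eq_true, Bool.or_eq_true, Bool.and_eq_true,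
      Nat.ble_eq, Nat.beq_eq] at hc
    rcases hc l hl m hm e he d hd with ⟨⟨h1, h2⟩, h3⟩ | hc
    -- The pair was excluded from the closure check: here the root of `x` has a child of order 3 and
    -- `y` would be a second one.
    · have : y.size = 3 := by
        by_cases hk0 : k = 0
        · omega
        · have := hk' hk0; omega
      rw [hfi h1 h2, this] at htxy
      simp at htxy
    · obtain ⟨l', hl', e', he', j, hj, hj', hfj, hdj⟩ := catalogued_iff hc
      refine ⟨l', hl', e', he', i + k + j, ?_, ?_, ?_, ?_⟩
      · simp only [size]; omega
      · intro h
        by_cases h0 : j = 0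
        · by_cases hi0 : i = 0
          · have := hk' (by omega); omega
          · have := hi' hi0; omega
        · exact hj' h0
      · intro h12 hf
        have hf' := hfj h12 hf
        have hj0 : j = 0 := by by_contra h0; have := hj' h0; omega
        have hi0 : i = 0 := by by_contra h0; have := hi' h0; omega
        have hk0 : k = 0 := by by_contra h0; have := hk' h0; omega
        simp only [Bool.or_eq_true, Nat.beq_eq] at hf'
        simp only [hasTriple, Bool.or_eq_true, beq_iff_eq]
        rcases hf' with hf' | hf'
        · exact Or.inl (hfi (by omega) hf')
        · right; omega
      · rw [pow_add, pow_add]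
        exact (hdi.attach hdk y.tame_profile (catalogue_spec hl he).1).trans hdj

/-- Cubing turns `c ≤ 3 ^ ((n - 1) / 3)` into an inequality between integers. The orders `11`, `12`
and `14` are exceptional. -/
def Bounded (n c : ℕ) : Prop :=
  (n = 11 ∧ c ≤ 42) ∨ (n = 12 ∧ c ≤ 59) ∨ (n = 14 ∧ c ≤ 117) ∨
    (n ≠ 11 ∧ n ≠ 12 ∧ n ≠ 14 ∧ c ^ 3 ≤ 3 ^ (n - 1))

theorem bounded_of_twinTriple_eq_false (t : RTree) (ht : t.twinTriple = false)
    (hn : 10 ≤ t.size) : Bounded t.size t.count := by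
  obtain ⟨l, hl, e, he, j, hj, hj', -, hd⟩ := exists_catalogue t ht
  obtain ⟨-, h10, h11, h12, h13⟩ := catalogue_spec hl he
  have hc : t.count ≤ 3 ^ j * e.2.total := hd.total
  by_cases h : 13 ≤ l.1
  · have hcube : t.count ^ 3 ≤ 3 ^ (t.size - 1) := by
      calc t.count ^ 3 ≤ (3 ^ j * e.2.total) ^ 3 := Nat.pow_le_pow_left hc 3
        _ = 3 ^ (3 * j) * e.2.total ^ 3 := by rw [mul_pow, ← pow_mul, mul_comm j]
        _ ≤ 3 ^ (3 * j) * 3 ^ (l.1 - 1) := Nat.mul_le_mul_left _ (h13 h)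
        _ = 3 ^ (t.size - 1) := by rw [← pow_add]; congr 1; omega
    by_cases h14 : t.size = 14
    · refine Or.inr (Or.inr (Or.inl ⟨h14, ?_⟩))
      rw [h14] at hcube
      by_contra hlt
      have : 118 ^ 3 ≤ t.count ^ 3 := Nat.pow_le_pow_left (by omega) 3
      norm_num at hcube this
      omega
    · exact Or.inr (Or.inr (Or.inr ⟨by omega, by omega, h14, hcube⟩))
  · have hj0 : j = 0 := by by_contra h0; exact h (hj' h0)
    subst hj0
    rw [pow_zero, one_mul] at hc
    have : t.size = l.1 := by omega
    unfold Bounded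
    have h3 : t.size = 10 ∨ t.size = 11 ∨ t.size = 12 := by omega
    rcases h3 with h3 | h3 | h3
    · have := h10 (by omega)
      refine Or.inr (Or.inr (Or.inr ⟨by omega, by omega, by omega, ?_⟩))
      rw [h3]
      calc t.count ^ 3 ≤ 27 ^ 3 := Nat.pow_le_pow_left (by omega) 3
        _ = _ := by norm_num
    · exact Or.inl ⟨h3, hc.trans (h11 (by omega))⟩
    · exact Or.inr (Or.inl ⟨h3, hc.trans (h12 (by omega))⟩)

/-! ### Changing the root -/

/-- The trees obtained from `glue X t` by moving the root to a vertex of `t`. -/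
def rootingsIn (X : RTree) : RTree → List RTree
  | single => [X]
  | attach x y => rootingsIn (attach X y) x ++ rootingsIn (attach single (glue X x)) y

/-- All rooted trees that arise from `t` by moving the root. -/
def rootings (t : RTree) : List RTree := rootingsIn single t

/-- All children of the root span subtrees of order `3`. -/
def isHub : RTree → Bool
  | single => true
  | attach x y => isHub x && y.size == 3

/-- Some vertex has the property that its removal leaves components of order `3` only. -/
def starlike (t : RTree) : Bool := t.rootings.any isHub

theorem starlike_iff {t : RTree} : t.starlike = true ↔ ∃ h ∈ t.rootings, h.isHub = true := by
  simp [starlike]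

theorem isHub_attach {x y : RTree} :
    (attach x y).isHub = true ↔ x.isHub = true ∧ y.size = 3 := by
  simp [isHub]

theorem isHub_glue {X t : RTree} :
    (glue X t).isHub = true ↔ X.isHub = true ∧ t.isHub = true := by
  induction t with
  | single => simp [glue, isHub]
  | attach x y hx _ => rw [glue, isHub_attach, isHub_attach, hx, and_assoc]

theorem size_mod_of_isHub {t : RTree} (h : t.isHub = true) : t.size % 3 = 1 := by
  induction t with
  | single => rfl
  | attach x y hx _ =>
    rw [isHub_attach] at h
    have := hx h.1
    simp only [size]; omega

theorem size_of_mem_rootingsIn {X t h : RTree} (hh : h ∈ rootingsIn X t) :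
    h.size + 1 = X.size + t.size := by
  induction t generalizing X with
  | single => simp only [rootingsIn, List.mem_singleton] at hh; subst hh; rfl
  | attach x y hx hy =>
    rw [rootingsIn, List.mem_append] at hh
    rcases hh with hh | hh
    · have := hx hh; simp only [size] at this ⊢; omega
    · have := hy hh; have := size_glue X x; simp only [size] at *; omega

theorem count_of_mem_rootingsIn {X t h : RTree} (hh : h ∈ rootingsIn X t) :
    h.count = (glue X t).count := by
  induction t generalizing X with
  | single => simp only [rootingsIn, List.mem_singleton] at hh; subst hh; rfl
  | attach x y hx hy =>
    rw [rootingsIn, List.mem_append] at hh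
    have e : (glue X (attach x y)).count = eval X.profile (x.profile.attach y.profile) := by
      rw [count, profile_glue]; rfl
    rcases hh with hh | hh
    · rw [hx hh, e, eval_attach_left, count, profile_glue]; rfl
    · rw [hy hh, e, eval_attach_right, count, profile_glue, profile, profile_glue]; rfl

theorem size_of_mem_rootings {t h : RTree} (hh : h ∈ t.rootings) : h.size = t.size := by
  have := size_of_mem_rootingsIn hh
  simp only [size] at this; omega

theorem count_of_mem_rootings {t h : RTree} (hh : h ∈ t.rootings) : h.count = t.count := by
  rw [count_of_mem_rootingsIn hh, single_glue]

theorem exists_isHub_mem_rootingsIn {X t : RTree} (hX : X.isHub = true) (ht : t.isHub = true) :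
    ∃ h ∈ rootingsIn X t, h.isHub = true := by
  induction t generalizing X with
  | single => exact ⟨X, by simp [rootingsIn], hX⟩
  | attach x y hx _ =>
    rw [isHub_attach] at ht
    obtain ⟨h, hh, hhub⟩ := hx (X := attach X y) (isHub_attach.2 ⟨hX, ht.2⟩) ht.1
    exact ⟨h, by rw [rootingsIn]; exact List.mem_append_left _ hh, hhub⟩

/-- A hub can only sit at the root of `t`: from any other vertex of `t`, the branch towards the root
contains all of `X` and so has order at least 4. -/
theorem isHub_of_mem_rootingsIn {X t h : RTree} (hX : 4 ≤ X.size) (hh : h ∈ rootingsIn X t)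
    (hhub : h.isHub = true) : X.isHub = true ∧ t.isHub = true := by
  induction t generalizing X with
  | single =>
    simp only [rootingsIn, List.mem_singleton] at hh; subst hh
    exact ⟨hhub, rfl⟩
  | attach x y hx hy =>
    rw [rootingsIn, List.mem_append] at hh
    have := x.size_pos
    have hs := size_glue X x
    rcases hh with hh | hh
    · obtain ⟨h1, h2⟩ := hx (by simp only [size]; omega) hh
      rw [isHub_attach] at h1
      exact ⟨h1.1, isHub_attach.2 ⟨h2, h1.2⟩⟩
    · obtain ⟨h1, -⟩ := hy (by simp only [size]; omega) hh
      rw [isHub_attach] at h1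
      omega

/-- The path `P₃`, rooted at its middle vertex. -/
def cherry : RTree := attach (attach single single) single

/-- The path `P₃`, rooted at an end. -/
def path3 : RTree := attach single (attach single single)

/-- The hub cannot lie in the cherry, because the branch towards `w` would have to be at the centre
of the cherry, whose other branches are single vertices. It cannot lie in `w` off the root, because
of the branch containing the cherry. -/
theorem isHub_of_starlike_attach_cherry {w : RTree} (hw : 3 ≤ w.size)
    (h : (attach w cherry).starlike = true) : w.isHub = true := by
  obtain ⟨t, ht, hhub⟩ := starlike_iff.1 h
  rw [rootings, rootingsIn, List.mem_append] at ht
  rcases ht with ht | ht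
  · exact (isHub_of_mem_rootingsIn (by decide) ht hhub).2
  · rw [single_glue] at ht
    have := (isHub_of_mem_rootingsIn (by simp only [size]; omega) ht hhub).2
    exact absurd this (by decide)

/-- The child of order 3 is moved to the outermost position. This changes the tree as an ordered
object, but not its profile. -/
theorem exists_of_hasTriple {x : RTree} (h : x.hasTriple = true) : ∃ w p : RTree, p.size = 3 ∧
    x.size = w.size + 3 ∧ x.profile = w.profile.attach p.profile ∧
      (w.isHub = true → x.isHub = true) := by
  induction x with
  | single => cases h
  | attach x y hx _ =>
    simp only [hasTriple, Bool.or_eq_true, beq_iff_eq] at h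
    by_cases hy : y.size = 3
    · exact ⟨x, y, hy, by simp only [size, hy], rfl, fun hw => isHub_attach.2 ⟨hw, hy⟩⟩
    · obtain ⟨w, p, hp, hs, hprof, hhub⟩ := hx (h.resolve_right hy)
      refine ⟨attach w y, p, hp, by simp only [size]; omega, ?_, fun hw => ?_⟩
      · rw [profile, profile, hprof, attach_attach_comm]
      · rw [isHub_attach] at hw; exact absurd hw.2 hy

/-- The root is moved to the vertex with the two children of order 3; `w` is everything else, seen
from there. If all branches of `w` have order 3 as well, this vertex is a hub of the whole tree. -/
theorem exists_of_twinTriple {X t : RTree} (h : t.twinTriple = true) : ∃ w p q : RTree,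
    p.size = 3 ∧ q.size = 3 ∧ (glue X t).size = w.size + 6 ∧
      (glue X t).count = (attach (attach w p) q).count ∧
      (w.isHub = true → ∃ h ∈ rootingsIn X t, h.isHub = true) := by
  induction t generalizing X with
  | single => cases h
  | attach x y hx hy =>
    simp only [twinTriple, Bool.or_eq_true, Bool.and_eq_true, beq_iff_eq] at h
    have e : (glue X (attach x y)).count = eval X.profile (x.profile.attach y.profile) := by
      rw [count, profile_glue]; rfl
    have hs := size_glue X (attach x y)
    rcases h with (h | h) | ⟨h, hy3⟩
    · obtain ⟨w, p, q, hp, hq, hsz, hc, hh⟩ := hx (X := attach X y) h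
      refine ⟨w, p, q, hp, hq, ?_, ?_, fun hw => ?_⟩
      · have := size_glue (attach X y) x; simp only [size] at *; omega
      · rw [← hc, e, eval_attach_left, count, profile_glue]; rfl
      · obtain ⟨t, ht, hhub⟩ := hh hw
        exact ⟨t, by rw [rootingsIn]; exact List.mem_append_left _ ht, hhub⟩
    · obtain ⟨w, p, q, hp, hq, hsz, hc, hh⟩ := hy (X := attach single (glue X x)) h
      refine ⟨w, p, q, hp, hq, ?_, ?_, fun hw => ?_⟩
      · have := size_glue (attach single (glue X x)) y; have := size_glue X x
        simp only [size] at *; omega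
      · rw [← hc, e, eval_attach_right, count, profile_glue, profile, profile_glue]; rfl
      · obtain ⟨t, ht, hhub⟩ := hh hw
        exact ⟨t, by rw [rootingsIn]; exact List.mem_append_right _ ht, hhub⟩
    · obtain ⟨w, p, hp, hsz, hprof, hhub⟩ := exists_of_hasTriple h
      refine ⟨glue X w, p, y, hp, hy3, ?_, ?_, fun hw => ?_⟩
      · have := size_glue X w; simp only [size] at *; omega
      · rw [e, hprof, eval, count, profile, profile, profile_glue, Profile.glue_attach,
          Profile.glue_attach]
      · rw [isHub_glue] at hw
        exact exists_isHub_mem_rootingsIn hw.1 (isHub_attach.2 ⟨hhub hw.2, hy3⟩)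

/-! ### Exhaustive checks for small orders -/

/-- Check a property for all rooted trees of order `n`, where `n` is at most the first argument. -/
def forallOfSize : ℕ → ℕ → (RTree → Bool) → Bool
  | 0, _, _ => true
  | f + 1, n, p => (!Nat.beq n 1 || p single) && (List.range n).all fun k =>
      forallOfSize f k fun x => forallOfSize f (n - k) fun y => p (attach x y)

theorem of_forallOfSize {f n : ℕ} {p : RTree → Bool} (h : forallOfSize f n p = true)
    (hn : n ≤ f) (t : RTree) (ht : t.size = n) : p t = true := by
  induction f generalizing n p t with
  | zero => have := t.size_pos; omega
  | succ f ih =>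
    simp only [forallOfSize, Bool.and_eq_true, List.all_eq_true, List.mem_range,
      Bool.or_eq_true, Bool.not_eq_true'] at h
    cases t with
    | single =>
      subst ht
      rcases h.1 with h1 | h1
      · exact absurd h1 (by decide)
      · exact h1
    | attach x y =>
      have hx := x.size_pos
      have hy := y.size_pos
      simp only [size] at ht
      have h1 := ih (h.2 x.size (by omega)) (by omega) x rfl
      exact ih h1 (by omega) y (by omega)

/-- The maximum of `count` over the trees of order `n ≤ 9`. -/
def smallMax : ℕ → ℕ
  | 1 => 1 | 2 => 1 | 3 => 3 | 4 => 4 | 5 => 5 | 6 => 6 | 7 => 11 | 8 => 15 | 9 => 19 | _ => 0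

theorem count_le_smallMax (t : RTree) (ht : t.size ≤ 9) : t.count ≤ smallMax t.size := by
  have h : ((List.range 10).all fun n => forallOfSize 9 n fun t =>
      Nat.ble t.count (smallMax n)) = true := by decide +kernel
  rw [List.all_eq_true] at h
  exact Nat.le_of_ble_eq_true
    (of_forallOfSize (h t.size (by rw [List.mem_range]; omega)) ht t rfl)

theorem starlike_of_size_eq_four (t : RTree) (ht : t.size = 4) : t.starlike = true := by
  have h : forallOfSize 4 4 starlike = true := by decide +kernel
  exact of_forallOfSize h le_rfl t ht

theorem starlike_or_of_size_eq_seven (t : RTree) (ht : t.size = 7) :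
    t.starlike = true ∨ t.count ≤ 9 := by
  have h : forallOfSize 7 7 (fun t => t.starlike || Nat.ble t.count 9) = true := by
    decide +kernel
  simpa using of_forallOfSize h le_rfl t ht

theorem eq_of_size_eq_three (t : RTree) (ht : t.size = 3) : t = cherry ∨ t = path3 := by
  have h : forallOfSize 3 3 (fun t => decide (t = cherry ∨ t = path3)) = true := by
    decide +kernel
  simpa using of_forallOfSize h le_rfl t ht

/-- These are the total orders 11, 12, 14 and 15, which the induction in `starlike_or_bounded`
cannot reach. -/
theorem count_attach_attach_of_size_le {w p q : RTree} (hp : p.size = 3) (hq : q.size = 3) :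
    (w.size = 5 → (attach (attach w p) q).count ≤ 42) ∧
    (w.size = 6 → (attach (attach w p) q).count ≤ 59) ∧
    (w.size = 8 → (attach (attach w p) q).count ≤ 117) ∧
    (w.size = 9 → (attach (attach w p) q).count ≤ 168) := by
  have h : ([(5, 42), (6, 59), (8, 117), (9, 168)].all fun a => forallOfSize 9 a.1 fun w =>
      [cherry, path3].all fun p => [cherry, path3].all fun q =>
        Nat.ble (attach (attach w p) q).count a.2) = true := by decide +kernel
  simp only [List.all_eq_true] at h
  have key : ∀ a ∈ [(5, 42), (6, 59), (8, 117), (9, 168)], a.1 ≤ 9 → w.size = a.1 →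
      (attach (attach w p) q).count ≤ a.2 := by
    intro a ha h9 hw
    have := of_forallOfSize (h a ha) h9 w hw
    simp only [List.all_eq_true, Nat.ble_eq] at this
    refine this p ?_ q ?_
    · simpa using eq_of_size_eq_three p hp
    · simpa using eq_of_size_eq_three q hq
  refine ⟨key (5, 42) (by simp) (by simp), key (6, 59) (by simp) (by simp),
    key (8, 117) (by simp) (by simp), key (9, 168) (by simp) (by simp)⟩

/-- Removing one of two pendant paths `P₃` at a vertex, and recentring the other. -/
theorem count_attach_attach_lt {w p q : RTree} (hp : p.size = 3) (hq : q.size = 3) :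
    (attach (attach w p) q).count + 1 ≤ 3 * (attach w cherry).count := by
  have hpos := w.soft_pos.1
  obtain ⟨h1, h2, h3, h4⟩ := w.tame_profile
  rcases eq_of_size_eq_three p hp with rfl | rfl <;>
  rcases eq_of_size_eq_three q hq with rfl | rfl <;>
  -- For two cherries the difference of the two sides before adding 1 is 2 * lone + 2 * pair + soft
  -- - 2 * bare - 2 * half, which tameness bounds below by soft > 0.
  simp [count, profile, cherry, path3, Profile.attach, Profile.single, Profile.total,
    Profile.del] at * <;> omega

/-- Trees with no vertex all of whose branches have order `3` have few maximal dissociation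
sets. -/
theorem starlike_or_bounded (t : RTree) (ht : t.size = 7 ∨ 10 ≤ t.size) :
    t.starlike = true ∨ Bounded t.size t.count := by
  induction hn : t.size using Nat.strong_induction_on generalizing t with
  | _ n ih =>
  subst hn
  rcases ht with h7 | h10
  · refine (starlike_or_of_size_eq_seven t h7).imp id fun h => ?_
    refine Or.inr (Or.inr (Or.inr ⟨by omega, by omega, by omega, ?_⟩))
    rw [h7]
    exact (Nat.pow_le_pow_left h 3).trans (by norm_num)
  by_cases htw : t.twinTriple = true
  swap
  · exact Or.inr (bounded_of_twinTriple_eq_false t (by simpa using htw) h10)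
  obtain ⟨w, p, q, hp, hq, hs, hc, hhub⟩ := exists_of_twinTriple (X := single) htw
  rw [single_glue] at hs hc
  have hsmall := count_attach_attach_of_size_le (w := w) hp hq
  have hlt := count_attach_attach_lt (w := w) hp hq
  rw [← hc] at hsmall hlt
  have hsz : (attach w cherry).size = w.size + 3 := rfl
  -- The inductive step lowers the order by 3. It is unavailable for 11 and 12, since orders 8 and 9
  -- are outside the claim, and too weak for 14 and 15, since the exceptional values 42 and 59 get
  -- tripled.
  by_cases h11 : t.size = 11
  · exact Or.inr (Or.inl ⟨h11, hsmall.1 (by omega)⟩)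
  by_cases h12 : t.size = 12
  · exact Or.inr (Or.inr (Or.inl ⟨h12, hsmall.2.1 (by omega)⟩))
  by_cases h14 : t.size = 14
  · exact Or.inr (Or.inr (Or.inr (Or.inl ⟨h14, hsmall.2.2.1 (by omega)⟩)))
  by_cases h15 : t.size = 15
  · refine Or.inr (Or.inr (Or.inr (Or.inr ⟨h11, h12, h14, ?_⟩)))
    rw [h15]
    exact (Nat.pow_le_pow_left (hsmall.2.2.2 (by omega)) 3).trans (by norm_num)
  rcases ih _ (by omega) (attach w cherry) (by omega) rfl with h | h
  · exact Or.inl (starlike_iff.2 (hhub (isHub_of_starlike_attach_cherry (by omega) h)))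
  · refine Or.inr (Or.inr (Or.inr (Or.inr ⟨h11, h12, h14, ?_⟩)))
    rcases h with h | h | h | ⟨-, -, -, h⟩
    · omega
    · omega
    -- The strict gain is essential here: 3 * 117 - 1 = 350, and 350 ^ 3 ≤ 3 ^ 16 < 351 ^ 3.
    · have : t.size = 17 := by omega
      rw [this]
      exact (Nat.pow_le_pow_left (show t.count ≤ 350 by omega) 3).trans (by norm_num)
    · calc t.count ^ 3 ≤ (3 * (attach w cherry).count) ^ 3 := Nat.pow_le_pow_left (by omega) 3
        _ = 3 ^ 3 * (attach w cherry).count ^ 3 := mul_pow _ _ _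
        _ ≤ 3 ^ 3 * 3 ^ ((attach w cherry).size - 1) := Nat.mul_le_mul_left _ h
        _ = 3 ^ (t.size - 1) := by rw [← pow_add]; congr 1; omega

end RTree
end Dissociation

namespace Dissociation
open SimpleGraph

/-! ### Maximal dissociation sets, locally -/

section Local
variable {V W : Type*} (G : SimpleGraph V) (H : SimpleGraph W)

/-- `v` has a neighbour in `S`. -/
def Touched (S : Set V) (v : V) : Prop := ∃ u ∈ S, G.Adj v u

/-- `v` has two neighbours in `S`. -/
def Crowded (S : Set V) (v : V) : Prop := ∃ u ∈ S, ∃ w ∈ S, u ≠ w ∧ G.Adj v u ∧ G.Adj v w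

/-- `v` cannot be added to the dissociation set `S`. -/
def Blocked (S : Set V) (v : V) : Prop := Crowded G S v ∨ ∃ u ∈ S, G.Adj v u ∧ Touched G S u

def Sparse (S : Set V) : Prop := ∀ v ∈ S, ¬ Crowded G S v

def IsMax (S : Set V) : Prop := Sparse G S ∧ ∀ v ∉ S, Blocked G S v

theorem isDissociationSet_iff (S : Set V) : IsDissociationSet G S ↔ Sparse G S := by
  simp only [IsDissociationSet, Set.encard_le_one_iff, Sparse, Crowded, Subtype.forall,
    mem_neighborSet, comap_adj, Function.Embedding.subtype_apply, Subtype.mk.injEq]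
  constructor
  · rintro h v hv ⟨u, hu, w, hw, hne, h1, h2⟩
    exact hne (h v hv u hu w hw h1 h2)
  · intro h v hv u hu w hw h1 h2
    by_contra hne
    exact h v hv ⟨u, hu, w, hw, hne, h1, h2⟩

theorem Sparse.subset {G : SimpleGraph V} {S T : Set V} (hT : Sparse G T) (h : S ⊆ T) :
    Sparse G S := fun v hv ⟨u, hu, w, hw, r⟩ => hT v (h hv) ⟨u, h hu, w, h hw, r⟩

theorem sparse_insert_iff {S : Set V} {v : V} (hS : Sparse G S) (hv : v ∉ S) :
    Sparse G (insert v S) ↔ ¬ Blocked G S v := by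
  constructor
  · rintro h (⟨u, hu, w, hw, r⟩ | ⟨u, hu, huv, w, hw, huw⟩)
    · exact h v (Set.mem_insert _ _) ⟨u, Or.inr hu, w, Or.inr hw, r⟩
    · exact h u (Or.inr hu) ⟨v, Or.inl rfl, w, Or.inr hw, fun e => hv (e ▸ hw), huv.symm, huw⟩
  · rintro h x (rfl | hx) ⟨u, hu, w, hw, hne, h1, h2⟩
    · have hu' : u ∈ S := hu.resolve_left h1.ne'
      have hw' : w ∈ S := hw.resolve_left h2.ne'
      exact h (Or.inl ⟨u, hu', w, hw', hne, h1, h2⟩)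
    · rcases hu with rfl | hu
      · have hw' : w ∈ S := hw.resolve_left hne.symm
        exact h (Or.inr ⟨x, hx, h1.symm, w, hw', h2⟩)
      · rcases hw with rfl | hw
        · exact h (Or.inr ⟨x, hx, h2.symm, u, hu, h1⟩)
        · exact hS x hx ⟨u, hu, w, hw, hne, h1, h2⟩

theorem maximal_iff (S : Set V) : Maximal (IsDissociationSet G) S ↔ IsMax G S := by
  have e : IsDissociationSet G = Sparse G := funext fun S => propext (isDissociationSet_iff G S)
  rw [e, Set.maximal_iff_forall_insert (fun _ _ h hs => h.subset hs), IsMax]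
  refine and_congr_right fun hS => forall₂_congr fun v hv => ?_
  rw [sparse_insert_iff G hS hv, not_not]

variable (r : V) (c : W)

/-- Everything but the root `r` is settled. -/
def Core (S : Set V) : Prop := Sparse G S ∧ ∀ v ∉ S, v ≠ r → Blocked G S v

def IsBlk (S : Set V) : Prop := r ∉ S ∧ Core G r S ∧ Blocked G S r
def IsBare (S : Set V) : Prop := r ∉ S ∧ Core G r S ∧ ¬ Blocked G S r ∧ ¬ Touched G S r
def IsHalf (S : Set V) : Prop := r ∉ S ∧ Core G r S ∧ ¬ Blocked G S r ∧ Touched G S r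
def IsLone (S : Set V) : Prop := r ∈ S ∧ IsMax G S ∧ ¬ Touched G S r
def IsPair (S : Set V) : Prop := r ∈ S ∧ IsMax G S ∧ Touched G S r
-- Neighbours of `r` are exempt because they become blocked as soon as `r` acquires a partner from
-- outside `G`.
def IsSoft (S : Set V) : Prop :=
  r ∈ S ∧ Sparse G S ∧ ¬ Touched G S r ∧ ∀ v ∉ S, ¬ G.Adj v r → Blocked G S v

theorem isMax_iff (S : Set V) : IsMax G S ↔ Core G r S ∧ (r ∉ S → Blocked G S r) := by
  constructor
  · exact fun h => ⟨⟨h.1, fun v hv _ => h.2 v hv⟩, h.2 r⟩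
  · rintro ⟨h, h'⟩
    refine ⟨h.1, fun v hv => ?_⟩
    by_cases hvr : v = r
    · subst hvr; exact h' hv
    · exact h.2 v hv hvr

theorem Blocked.touched {G : SimpleGraph V} {S : Set V} {v : V} (h : Blocked G S v) :
    Touched G S v := by
  rcases h with ⟨u, hu, w, hw, hne, h1, h2⟩ | ⟨u, hu, h1, h2⟩
  exacts [⟨u, hu, h1⟩, ⟨u, hu, h1⟩]

/-- Two rooted graphs with an edge between the roots. -/
def joinRoots : SimpleGraph (V ⊕ W) where
  Adj
    | .inl a, .inl b => G.Adj a b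
    | .inr a, .inr b => H.Adj a b
    | .inl a, .inr b => a = r ∧ b = c
    | .inr b, .inl a => a = r ∧ b = c
  symm := ⟨by rintro (a | a) (b | b) h <;> first | exact h.symm | exact h⟩
  loopless := ⟨by rintro (a | a) h <;> exact SimpleGraph.irrefl _ h⟩

@[simp] theorem joinRoots_inl_inl {a b : V} :
    (joinRoots G H r c).Adj (.inl a) (.inl b) ↔ G.Adj a b := Iff.rfl
@[simp] theorem joinRoots_inr_inr {a b : W} :
    (joinRoots G H r c).Adj (.inr a) (.inr b) ↔ H.Adj a b := Iff.rfl
@[simp] theorem joinRoots_inl_inr {a : V} {b : W} :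
    (joinRoots G H r c).Adj (.inl a) (.inr b) ↔ a = r ∧ b = c := Iff.rfl
@[simp] theorem joinRoots_inr_inl {a : V} {b : W} :
    (joinRoots G H r c).Adj (.inr b) (.inl a) ↔ a = r ∧ b = c := Iff.rfl

variable (S : Set (V ⊕ W))

theorem touched_inl (v : V) : Touched (joinRoots G H r c) S (.inl v) ↔
    Touched G (Sum.inl ⁻¹' S) v ∨ (v = r ∧ .inr c ∈ S) := by
  simp only [Touched, Sum.exists, joinRoots_inl_inl, joinRoots_inl_inr, Set.mem_preimage]
  grind

theorem touched_inr (w : W) : Touched (joinRoots G H r c) S (.inr w) ↔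
    Touched H (Sum.inr ⁻¹' S) w ∨ (w = c ∧ .inl r ∈ S) := by
  simp only [Touched, Sum.exists, joinRoots_inr_inl, joinRoots_inr_inr, Set.mem_preimage]
  grind

theorem crowded_inl (v : V) : Crowded (joinRoots G H r c) S (.inl v) ↔
    Crowded G (Sum.inl ⁻¹' S) v ∨
      (v = r ∧ .inr c ∈ S ∧ Touched G (Sum.inl ⁻¹' S) r) := by
  simp only [Crowded, Touched, Sum.exists, joinRoots_inl_inl, joinRoots_inl_inr,
    Set.mem_preimage, ne_eq, Sum.inl.injEq, Sum.inr.injEq, reduceCtorEq, not_false_eq_true]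
  grind

theorem crowded_inr (w : W) : Crowded (joinRoots G H r c) S (.inr w) ↔
    Crowded H (Sum.inr ⁻¹' S) w ∨
      (w = c ∧ .inl r ∈ S ∧ Touched H (Sum.inr ⁻¹' S) c) := by
  simp only [Crowded, Touched, Sum.exists, joinRoots_inr_inl, joinRoots_inr_inr,
    Set.mem_preimage, ne_eq, Sum.inl.injEq, Sum.inr.injEq, reduceCtorEq, not_false_eq_true]
  grind

theorem blocked_inl (v : V) : Blocked (joinRoots G H r c) S (.inl v) ↔
    Blocked G (Sum.inl ⁻¹' S) v ∨ (v = r ∧ .inr c ∈ S ∧ (Touched G (Sum.inl ⁻¹' S) r ∨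
      Touched H (Sum.inr ⁻¹' S) c ∨ .inl r ∈ S)) ∨
      (.inl r ∈ S ∧ .inr c ∈ S ∧ G.Adj v r) := by
  simp only [Blocked, crowded_inl, touched_inl, touched_inr, Sum.exists, joinRoots_inl_inl,
    joinRoots_inl_inr, Set.mem_preimage]
  grind

theorem blocked_inr (w : W) : Blocked (joinRoots G H r c) S (.inr w) ↔
    Blocked H (Sum.inr ⁻¹' S) w ∨ (w = c ∧ .inl r ∈ S ∧ (Touched H (Sum.inr ⁻¹' S) c ∨
      Touched G (Sum.inl ⁻¹' S) r ∨ .inr c ∈ S)) ∨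
      (.inl r ∈ S ∧ .inr c ∈ S ∧ H.Adj w c) := by
  simp only [Blocked, crowded_inr, touched_inl, touched_inr, Sum.exists, joinRoots_inr_inl,
    joinRoots_inr_inr, Set.mem_preimage]
  grind

theorem sparse_joinRoots : Sparse (joinRoots G H r c) S ↔
    Sparse G (Sum.inl ⁻¹' S) ∧ Sparse H (Sum.inr ⁻¹' S) ∧ (.inl r ∈ S → .inr c ∈ S →
      ¬ Touched G (Sum.inl ⁻¹' S) r ∧ ¬ Touched H (Sum.inr ⁻¹' S) c) := by
  simp only [Sparse, Sum.forall, crowded_inl, crowded_inr, Set.mem_preimage]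
  grind

/-- The only link between `H` and the rest is `r`; as it is not chosen, `H` must be settled by
itself. -/
theorem core_joinRoots_of_notMem (hr : .inl r ∉ S) : Core (joinRoots G H r c) (.inl r) S ↔
    Core G r (Sum.inl ⁻¹' S) ∧ IsMax H (Sum.inr ⁻¹' S) := by
  simp only [Core, IsMax, sparse_joinRoots, Sum.forall, blocked_inl, blocked_inr,
    Set.mem_preimage, hr, false_and, and_false, or_false, false_imp_iff, ne_eq,
    Sum.inl.injEq, reduceCtorEq, not_false_eq_true, true_imp_iff, and_true]
  grind

/-- If `c` is not chosen, it must be blocked inside `H`, or have a second chosen neighbour besides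
`r`, or be kept out because `r` already has a partner. If `c` is chosen, the edge between the roots
is a component that blocks all their other neighbours, hence two `IsSoft` sides. -/
theorem isMax_joinRoots_of_mem (hr : .inl r ∈ S) : IsMax (joinRoots G H r c) S ↔
    (.inr c ∉ S ∧ IsMax G (Sum.inl ⁻¹' S) ∧ Core H c (Sum.inr ⁻¹' S) ∧
      (Blocked H (Sum.inr ⁻¹' S) c ∨ Touched H (Sum.inr ⁻¹' S) c ∨
        Touched G (Sum.inl ⁻¹' S) r)) ∨
    (IsSoft G r (Sum.inl ⁻¹' S) ∧ IsSoft H c (Sum.inr ⁻¹' S)) := by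
  by_cases hc : .inr c ∈ S <;>
  simp only [Core, IsMax, IsSoft, sparse_joinRoots, Sum.forall, blocked_inl, blocked_inr,
    Set.mem_preimage, hr, hc, false_and, and_false, or_false, false_imp_iff, ne_eq, or_true,
    not_false_eq_true, not_true_eq_false, true_imp_iff, and_true, true_and, false_or] <;>
  grind

theorem isSoft_joinRoots : IsSoft (joinRoots G H r c) (.inl r) S ↔
    IsSoft G r (Sum.inl ⁻¹' S) ∧ .inr c ∉ S ∧ Core H c (Sum.inr ⁻¹' S) := by
  by_cases hc : .inr c ∈ S <;>
  simp only [Core, IsSoft, sparse_joinRoots, Sum.forall, blocked_inl, blocked_inr, touched_inl,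
    joinRoots_inl_inl, joinRoots_inr_inl,
    Set.mem_preimage, hc, false_and, and_false, or_false, false_imp_iff, ne_eq, or_true,
    not_false_eq_true, not_true_eq_false, true_imp_iff, and_true, true_and]
  grind

end Local
end Dissociation

namespace Dissociation
open SimpleGraph

/-! ### Counting sets over disjoint unions and joined roots -/

section Count
variable {V W : Type*}

/-- The number of vertex sets with a given property. -/
noncomputable def num (p : Set V → Prop) : ℕ := {S | p S}.ncard

theorem num_congr {p q : Set V → Prop} (h : ∀ S, p S ↔ q S) : num p = num q := by
  rw [funext fun S => propext (h S)]

theorem num_and (p : Set V → Prop) (q : Set W → Prop) :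
    num (fun S : Set (V ⊕ W) => p (Sum.inl ⁻¹' S) ∧ q (Sum.inr ⁻¹' S)) = num p * num q := by
  unfold num
  rw [← Set.ncard_prod]
  refine Set.ncard_congr (fun S _ => (Sum.inl ⁻¹' S, Sum.inr ⁻¹' S)) (fun S hS => hS) ?_ ?_
  · intro S T _ _ h
    rw [Prod.mk.injEq] at h
    ext (x | x)
    · exact Set.ext_iff.1 h.1 x
    · exact Set.ext_iff.1 h.2 x
  · rintro ⟨S, T⟩ h
    refine ⟨Sum.inl '' S ∪ Sum.inr '' T, ?_, ?_⟩
    · simpa [Set.preimage_image_eq, Sum.inl_injective, Sum.inr_injective] using h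
    · simp [Set.preimage_image_eq, Sum.inl_injective, Sum.inr_injective]

theorem numMaxDissociationSets_eq_num (G : SimpleGraph V) :
    numMaxDissociationSets G = num (IsMax G) :=
  num_congr (maximal_iff G)

theorem isMax_sum (G : SimpleGraph V) (H : SimpleGraph W) (S : Set (V ⊕ W)) :
    IsMax (G ⊕g H) S ↔ IsMax G (Sum.inl ⁻¹' S) ∧ IsMax H (Sum.inr ⁻¹' S) := by
  have h1 (a b : V) : (G ⊕g H).Adj (.inl a) (.inl b) ↔ G.Adj a b := Iff.rfl
  have h2 (a b : W) : (G ⊕g H).Adj (.inr a) (.inr b) ↔ H.Adj a b := Iff.rfl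
  have h3 (a : V) (b : W) : (G ⊕g H).Adj (.inl a) (.inr b) ↔ False := by simp
  have h4 (a : V) (b : W) : (G ⊕g H).Adj (.inr b) (.inl a) ↔ False := by simp
  simp only [IsMax, Sparse, Blocked, Crowded, Touched, Sum.forall, Sum.exists, h1, h2, h3, h4,
    Set.mem_preimage, ne_eq, Sum.inl.injEq, Sum.inr.injEq, and_false, false_and, exists_false,
    or_false, false_or, reduceCtorEq, not_false_eq_true]
  tauto

theorem numMaxDissociationSets_congr {G : SimpleGraph V} {H : SimpleGraph W} (e : G ≃g H) :
    numMaxDissociationSets G = numMaxDissociationSets H := by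
  rw [numMaxDissociationSets_eq_num, numMaxDissociationSets_eq_num]
  have key : ∀ S : Set W, IsMax G (e ⁻¹' S) ↔ IsMax H S := by
    intro S
    have ht : ∀ v, Touched G (e ⁻¹' S) v ↔ Touched H S (e v) := fun v => by
      simp only [Touched, e.surjective.exists, Set.mem_preimage, e.map_adj_iff]
    have hc : ∀ v, Crowded G (e ⁻¹' S) v ↔ Crowded H S (e v) := fun v => by
      simp only [Crowded, e.surjective.exists, Set.mem_preimage, e.map_adj_iff, ne_eq,
        e.injective.eq_iff]
    simp only [IsMax, Sparse, Blocked, e.surjective.forall, e.surjective.exists, ht, hc,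
      Set.mem_preimage, e.map_adj_iff]
  refine (Set.ncard_congr (fun S _ => e ⁻¹' S) (fun S hS => (key S).2 hS) ?_ ?_).symm
  · intro S T _ _ h
    exact e.surjective.preimage_injective h
  · intro S hS
    refine ⟨e.symm ⁻¹' S, ?_, ?_⟩
    · refine (key _).1 ?_
      rwa [← Set.preimage_comp, show ⇑e.symm ∘ ⇑e = id from funext e.symm_apply_apply]
    · ext x; simp

theorem numMaxDissociationSets_sum (G : SimpleGraph V) (H : SimpleGraph W) :
    numMaxDissociationSets (G ⊕g H) = numMaxDissociationSets G * numMaxDissociationSets H := by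
  simp only [numMaxDissociationSets_eq_num]
  rw [← num_and]
  exact num_congr (isMax_sum G H)

variable [Finite V] [Finite W]

theorem num_or {p q : Set V → Prop} (h : ∀ S, p S → ¬ q S) :
    num (fun S => p S ∨ q S) = num p + num q :=
  Set.ncard_union_eq (Set.disjoint_left.2 h) (Set.toFinite _) (Set.toFinite _)

theorem num_isMax (G : SimpleGraph V) (r : V) :
    num (IsMax G) = num (IsBlk G r) + num (IsLone G r) + num (IsPair G r) := by
  rw [← num_or, ← num_or]
  · refine num_congr fun S => ?_
    have := isMax_iff G r S
    simp only [IsBlk, IsLone, IsPair]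
    tauto
  · rintro S (h | h) h'
    · exact h.1 h'.1
    · exact h.2.2 h'.2.2
  · exact fun S h h' => h.1 h'.1

theorem num_core (G : SimpleGraph V) (r : V) : num (fun S => r ∉ S ∧ Core G r S) =
    num (IsBlk G r) + num (IsBare G r) + num (IsHalf G r) := by
  rw [← num_or, ← num_or]
  · refine num_congr fun S => ?_
    simp only [IsBlk, IsBare, IsHalf]
    tauto
  · rintro S (h | h) h'
    · exact h'.2.2.1 h.2.2
    · exact h.2.2.2 h'.2.2.2
  · exact fun S h h' => h'.2.2.1 h.2.2

/-- The profile `p` counts the six types of vertex sets in the graph `G` with root `r`. -/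
structure HasProfile (G : SimpleGraph V) (r : V) (p : Profile) : Prop where
  blk : num (IsBlk G r) = p.blk
  bare : num (IsBare G r) = p.bare
  half : num (IsHalf G r) = p.half
  lone : num (IsLone G r) = p.lone
  pair : num (IsPair G r) = p.pair
  soft : num (IsSoft G r) = p.soft

variable {G : SimpleGraph V} {H : SimpleGraph W} {r : V} {c : W} {p q : Profile}

theorem HasProfile.total (h : HasProfile G r p) : num (IsMax G) = p.total := by
  rw [num_isMax G r, h.blk, h.lone, h.pair]; rfl

theorem HasProfile.del (h : HasProfile G r p) :
    num (fun S => r ∉ S ∧ Core G r S) = p.del := by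
  rw [num_core G r, h.blk, h.bare, h.half]; rfl

/-- Each sum of products in `Profile.attach` is a disjoint union of product families of sets
(`num_or`, `num_and`), so each field reduces to a propositional equivalence for a single set. -/
theorem HasProfile.joinRoots (hG : HasProfile G r p) (hH : HasProfile H c q) :
    HasProfile (joinRoots G H r c) (.inl r) (p.attach q) where
  blk := by
    rw [show (p.attach q).blk = p.blk * q.total + (p.bare * q.pair +
      p.half * (q.lone + q.pair)) from add_assoc _ _ _, ← hG.blk, ← hH.total, ← hG.bare,
      ← hH.pair, ← hG.half, ← hH.lone, ← num_or, ← num_and, ← num_and, ← num_and, ← num_or,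
      ← num_or]
    · refine num_congr fun S => ?_
      have := isMax_iff H c (Sum.inr ⁻¹' S)
      by_cases hr : .inl r ∈ S
      · simp [IsBlk, IsBare, IsHalf, hr]
      · simp only [IsBlk, IsBare, IsHalf, IsLone, IsPair, core_joinRoots_of_notMem _ _ _ _ _ hr,
          blocked_inl, Set.mem_preimage, hr, false_and, or_false, not_false_eq_true, true_and]
        tauto
    · rintro S ⟨h, -⟩ (⟨h', -⟩ | ⟨h', -⟩)
      · exact h'.2.2.1 h.2.2
      · exact h'.2.2.1 h.2.2
    · rintro S ⟨h, -⟩ ⟨h', -⟩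
      exact h.2.2.2 h'.2.2.2
    · exact fun S h h' => h.2.2 h'.2.2
  bare := by
    rw [show (p.attach q).bare = p.bare * q.blk from rfl, ← hG.bare, ← hH.blk, ← num_and]
    refine num_congr fun S => ?_
    have := isMax_iff H c (Sum.inr ⁻¹' S)
    by_cases hr : .inl r ∈ S
    · simp [IsBare, hr]
    · simp only [IsBlk, IsBare, core_joinRoots_of_notMem _ _ _ _ _ hr, touched_inl,
        blocked_inl, Set.mem_preimage, hr, false_and, or_false, not_false_eq_true, true_and]
      tauto
  half := by
    rw [show (p.attach q).half = p.bare * q.lone + p.half * q.blk from rfl, ← hG.bare,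
      ← hH.lone, ← hG.half, ← hH.blk, ← num_and, ← num_and, ← num_or]
    · refine num_congr fun S => ?_
      have := isMax_iff H c (Sum.inr ⁻¹' S)
      by_cases hr : .inl r ∈ S
      · simp [IsBare, IsHalf, hr]
      · simp only [IsBlk, IsBare, IsHalf, IsLone, core_joinRoots_of_notMem _ _ _ _ _ hr,
          touched_inl, blocked_inl, Set.mem_preimage, hr, false_and, or_false,
          not_false_eq_true, true_and]
        tauto
    · rintro S ⟨h, -⟩ ⟨h', -⟩
      exact h.2.2.2 h'.2.2.2
  lone := by
    rw [show (p.attach q).lone = p.lone * (q.blk + q.half) from rfl, ← hG.lone, ← hH.blk,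
      ← hH.half, ← num_or, ← num_and]
    · refine num_congr fun S => ?_
      have := @Blocked.touched W H (Sum.inr ⁻¹' S) c
      by_cases hr : .inl r ∈ S
      · by_cases hc : .inr c ∈ S
        · simp [IsLone, IsBlk, IsHalf, touched_inl, hc]
        · simp only [IsBlk, IsHalf, IsLone, IsSoft, isMax_joinRoots_of_mem _ _ _ _ _ hr,
            touched_inl, Set.mem_preimage, hr, hc]
          tauto
      · simp [IsLone, hr]
    · exact fun S h h' => h'.2.2.1 h.2.2
  pair := by
    rw [show (p.attach q).pair = p.pair * q.del + p.soft * q.soft from rfl, ← hG.pair,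
      ← hH.del, ← hG.soft, ← hH.soft, ← num_and, ← num_and, ← num_or]
    · refine num_congr fun S => ?_
      by_cases hr : .inl r ∈ S
      · simp only [IsPair, IsSoft, isMax_joinRoots_of_mem _ _ _ _ _ hr,
            touched_inl, Set.mem_preimage, hr]
        tauto
      · simp [IsPair, IsSoft, hr]
    · rintro S ⟨h, -⟩ ⟨h', -⟩
      exact h'.2.2.1 h.2.2
  soft := by
    rw [show (p.attach q).soft = p.soft * q.del from rfl, ← hG.soft, ← hH.del, ← num_and]
    exact num_congr fun S => isSoft_joinRoots G H r c S

end Count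

theorem hasProfile_single (G : SimpleGraph Unit) : HasProfile G () Profile.single := by
  have hadj : ∀ a b, ¬ G.Adj a b := fun a b h => h.ne (Subsingleton.elim a b)
  have h0 : ∀ p : Set Unit → Prop, (∀ S, ¬ p S) → num p = 0 := fun p h => by
    rw [num, Set.ncard_eq_zero]; ext S; simp [h]
  have h1 : ∀ (p : Set Unit → Prop) (T : Set Unit), (∀ S, p S ↔ S = T) → num p = 1 :=
    fun p T h => by rw [num, Set.ncard_eq_one]; exact ⟨T, by ext S; simp [h]⟩
  have hmem : ∀ S : Set Unit, () ∈ S ↔ S = {()} := fun S => by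
    constructor
    · intro h; ext ⟨⟩; simp [h]
    · rintro rfl; rfl
  have hnot : ∀ S : Set Unit, () ∉ S ↔ S = ∅ := fun S => by
    constructor
    · intro h; ext ⟨⟩; simp [h]
    · rintro rfl; simp
  constructor
  · exact h0 _ fun S => by simp [IsBlk, Blocked, Crowded, Touched]
  · refine h1 _ ∅ fun S => ?_
    simp [IsBare, Core, Sparse, Blocked, Crowded, Touched, hnot]
  · exact h0 _ fun S => by simp [IsHalf, Touched]
  · refine h1 _ {()} fun S => ?_
    simp only [IsLone, IsMax, Sparse, Blocked, Crowded, Touched, hadj, ← hmem]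
    simp
    exact fun h _ => h
  · exact h0 _ fun S => by simp [IsPair, Touched]
  · refine h1 _ {()} fun S => ?_
    simp only [IsSoft, Sparse, Blocked, Crowded, Touched, hadj, ← hmem]
    simp
    exact fun h _ => h

/-! ### Rooted trees as graphs -/

namespace RTree

/-- The vertices of a rooted tree. -/
def V : RTree → Type
  | single => Unit
  | attach x y => x.V ⊕ y.V

instance instFintypeV : ∀ t : RTree, Fintype t.V
  | single => inferInstanceAs (Fintype Unit)
  | attach x y => @instFintypeSum _ _ (instFintypeV x) (instFintypeV y)

def root : ∀ t : RTree, t.V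
  | single => ()
  | attach x _ => Sum.inl x.root

def graph : ∀ t : RTree, SimpleGraph t.V
  | single => (⊥ : SimpleGraph Unit)
  | attach x y => joinRoots x.graph y.graph x.root y.root

theorem card_V (t : RTree) : Fintype.card t.V = t.size := by
  induction t with
  | single => rfl
  | attach x y hx hy => rw [size, ← hx, ← hy]; exact Fintype.card_sum

theorem hasProfile (t : RTree) : HasProfile t.graph t.root t.profile := by
  induction t with
  | single => exact hasProfile_single _
  | attach x y hx hy => exact hx.joinRoots hy

theorem numMaxDissociationSets_graph (t : RTree) :
    numMaxDissociationSets t.graph = t.count := by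
  rw [numMaxDissociationSets_eq_num, t.hasProfile.total]; rfl

end RTree
end Dissociation

namespace Dissociation
open SimpleGraph

/-! ### Isomorphisms between joined graphs -/

section Join
variable {V W U V' W' : Type*} {G : SimpleGraph V} {H : SimpleGraph W} {K : SimpleGraph U}
  {G' : SimpleGraph V'} {H' : SimpleGraph W'}

def joinCongr {r : V} {c : W} {r' : V'} {c' : W'} (e : G ≃g G') (f : H ≃g H') (he : e r = r')
    (hf : f c = c') : joinRoots G H r c ≃g joinRoots G' H' r' c' where
  toEquiv := Equiv.sumCongr e.toEquiv f.toEquiv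
  map_rel_iff' := by
    subst he hf
    rintro (a | a) (b | b)
    · exact e.map_rel_iff
    · exact and_congr e.injective.eq_iff f.injective.eq_iff
    · exact and_congr e.injective.eq_iff f.injective.eq_iff
    · exact f.map_rel_iff

def joinSwap (r : V) (c : W) : joinRoots G H r c ≃g joinRoots H G c r where
  toEquiv := Equiv.sumComm V W
  map_rel_iff' := by
    rintro (a | a) (b | b)
    exacts [Iff.rfl, and_comm, and_comm, Iff.rfl]

def joinAssoc (r : V) (c s : W) (k : U) :
    joinRoots (joinRoots G H r c) K (.inr s) k ≃g joinRoots G (joinRoots H K s k) r (.inl c) where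
  toEquiv := Equiv.sumAssoc V W U
  map_rel_iff' := by
    rintro ((a | a) | a) ((b | b) | b) <;>
      simp [Equiv.sumAssoc_apply_inl_inl, Equiv.sumAssoc_apply_inl_inr]

def sumRightComm (α β γ : Type*) : (α ⊕ β) ⊕ γ ≃ (α ⊕ γ) ⊕ β where
  toFun
    | .inl (.inl a) => .inl (.inl a)
    | .inl (.inr b) => .inr b
    | .inr c => .inl (.inr c)
  invFun
    | .inl (.inl a) => .inl (.inl a)
    | .inl (.inr b) => .inr b
    | .inr c => .inl (.inr c)
  left_inv := by rintro ((a | a) | a) <;> rfl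
  right_inv := by rintro ((a | a) | a) <;> rfl

def joinRightComm (r s : V) (c : W) (k : U) :
    joinRoots (joinRoots G H r c) K (.inl s) k ≃g
      joinRoots (joinRoots G K s k) H (.inl r) c where
  toEquiv := sumRightComm V W U
  map_rel_iff' := by
    rintro ((a | a) | a) ((b | b) | b) <;> simp [sumRightComm]

end Join

namespace RTree

/-- Isomorphism of rooted trees. -/
def Equivalent (s t : RTree) : Prop := ∃ e : s.graph ≃g t.graph, e s.root = t.root

theorem Equivalent.refl (t : RTree) : t.Equivalent t := ⟨Iso.refl, rfl⟩

theorem Equivalent.trans {s t u : RTree} (h : s.Equivalent t) (h' : t.Equivalent u) :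
    s.Equivalent u := by
  obtain ⟨e, he⟩ := h
  obtain ⟨f, hf⟩ := h'
  exact ⟨f.comp e, by simp [he, hf]⟩

theorem Equivalent.attach {x y x' y' : RTree} (h : x.Equivalent x') (h' : y.Equivalent y') :
    (x.attach y).Equivalent (x'.attach y') := by
  obtain ⟨e, he⟩ := h
  obtain ⟨f, hf⟩ := h'
  exact ⟨joinCongr e f he hf, congrArg Sum.inl he⟩

theorem equivalent_attach_attach (x y z : RTree) :
    ((x.attach y).attach z).Equivalent ((x.attach z).attach y) :=
  ⟨joinRightComm x.root x.root y.root z.root, rfl⟩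

theorem glue_attach_equivalent (X w x : RTree) :
    (glue (attach X w) x).Equivalent (attach (glue X x) w) := by
  induction x with
  | single => exact Equivalent.refl _
  | attach a b ha _ =>
    exact (ha.attach (Equivalent.refl b)).trans (equivalent_attach_attach _ _ _)

theorem nonempty_iso_of_mem_rootingsIn {X t h : RTree} (hh : h ∈ rootingsIn X t) :
    Nonempty (h.graph ≃g (glue X t).graph) := by
  induction t generalizing X with
  | single =>
    simp only [rootingsIn, List.mem_singleton] at hh
    subst hh
    exact ⟨Iso.refl⟩
  | attach x y hx hy =>
    rw [rootingsIn, List.mem_append] at hh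
    rcases hh with hh | hh
    · obtain ⟨e⟩ := hx hh
      obtain ⟨f, -⟩ := glue_attach_equivalent X y x
      exact ⟨f.comp e⟩
    · obtain ⟨e⟩ := hy hh
      obtain ⟨f, -⟩ := glue_attach_equivalent single (glue X x) y
      rw [single_glue] at f
      exact ⟨((joinSwap y.root (glue X x).root).comp f).comp e⟩

theorem nonempty_iso_of_mem_rootings {t h : RTree} (hh : h ∈ t.rootings) :
    Nonempty (h.graph ≃g t.graph) := by
  have := nonempty_iso_of_mem_rootingsIn hh
  rwa [single_glue] at this

/-- Add a pendant vertex at `v`. -/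
def addLeaf : ∀ t : RTree, t.V → RTree
  | single, _ => attach single single
  | attach x y, .inl v => attach (x.addLeaf v) y
  | attach x y, .inr v => attach x (y.addLeaf v)

theorem exists_iso_addLeaf (t : RTree) (v : t.V) :
    ∃ e : (t.addLeaf v).graph ≃g joinRoots t.graph (⊥ : SimpleGraph Unit) v (),
      e (t.addLeaf v).root = .inl t.root := by
  induction t with
  | single => exact ⟨Iso.refl, rfl⟩
  | attach x y hx hy =>
    rcases v with v | v
    · obtain ⟨e, he⟩ := hx v
      refine ⟨(joinRightComm _ _ _ _).comp (joinCongr e Iso.refl he rfl), ?_⟩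
      exact congrArg (fun z => sumRightComm x.V Unit y.V (Sum.inl z)) he
    · obtain ⟨e, he⟩ := hy v
      exact ⟨(joinAssoc _ _ _ _).symm.comp (joinCongr Iso.refl e rfl he), rfl⟩

end RTree

/-- Every finite tree comes from a rooted tree. -/
theorem exists_rtree {V : Type*} [Finite V] (G : SimpleGraph V) (hG : G.IsTree) :
    ∃ t : RTree, Nonempty (t.graph ≃g G) := by
  classical
  induction h : Nat.card V generalizing V with
  | zero =>
    have := hG.connected.nonempty
    exact absurd h Nat.card_pos.ne'
  | succ n ih =>
    have := Fintype.ofFinite V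
    have := hG.connected.nonempty
    rcases subsingleton_or_nontrivial V with hV | hV
    · have : Unique V := Classical.choice ⟨⟨⟨this.some⟩, fun a => Subsingleton.elim _ _⟩⟩
      refine ⟨.single, ⟨⟨(Equiv.ofUnique Unit V : _), ?_⟩⟩⟩
      intro a b
      exact iff_of_false (fun h => h.ne (Subsingleton.elim _ _)) (fun h => h)
    -- A leaf is deleted, and `addLeaf` puts it back at its neighbour.
    · obtain ⟨v, hv⟩ := hG.exists_vert_degree_one_of_nontrivial
      have hconn := hG.connected.induce_compl_singleton_of_degree_eq_one hv
      have hT : (G.induce {v}ᶜ).IsTree := ⟨hconn, hG.isAcyclic.induce _⟩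
      obtain ⟨t, ⟨e⟩⟩ := ih (G.induce {v}ᶜ) hT (by
        rw [Nat.card_eq_fintype_card] at h ⊢
        rw [Fintype.card_compl_set]; simp [h])
      obtain ⟨u, hu, hu'⟩ := degree_eq_one_iff_existsUnique_adj.1 hv
      obtain ⟨f, -⟩ := t.exists_iso_addLeaf (e.symm ⟨u, hu.ne'⟩)
      refine ⟨_, ⟨Iso.comp ?_ f⟩⟩
      refine Iso.comp ?_ (joinCongr (r' := (⟨u, hu.ne'⟩ : ({v}ᶜ : Set V))) e Iso.refl (by simp) rfl)
      refine ⟨(Equiv.sumCongr (Equiv.refl _) (Equiv.ofUnique Unit ({v} : Set V))).trans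
        ((Equiv.sumComm _ _).trans (Equiv.Set.sumCompl {v})), ?_⟩
      have hadj (a : ({v}ᶜ : Set V)) : G.Adj v a ↔ a = ⟨u, hu.ne'⟩ :=
        ⟨fun h => Subtype.ext (hu' _ h), fun h => h ▸ hu⟩
      rintro (a | a) (b | b)
      · simp
      · simp [G.adj_comm a v, hadj]
      · simp [hadj]
      · simp

/-! ### Forests as lists of trees -/

/-- The vertices of a disjoint union of rooted trees. -/
def forestV : List RTree → Type
  | [] => Empty
  | t :: l => t.V ⊕ forestV l

instance instFintypeForestV : ∀ l : List RTree, Fintype (forestV l)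
  | [] => inferInstanceAs (Fintype Empty)
  | t :: l => @instFintypeSum _ _ (RTree.instFintypeV t) (instFintypeForestV l)

def forestGraph : ∀ l : List RTree, SimpleGraph (forestV l)
  | [] => ⊥
  | t :: l => t.graph ⊕g forestGraph l

theorem card_forestV (l : List RTree) :
    Fintype.card (forestV l) = (l.map RTree.size).sum := by
  induction l with
  | nil => rfl
  | cons t l ih =>
    rw [List.map_cons, List.sum_cons, ← ih, ← t.card_V]; exact Fintype.card_sum

theorem numMaxDissociationSets_of_isEmpty {V : Type*} [IsEmpty V] (G : SimpleGraph V) :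
    numMaxDissociationSets G = 1 := by
  rw [numMaxDissociationSets_eq_num, num, Set.ncard_eq_one]
  refine ⟨∅, Set.eq_singleton_iff_unique_mem.2 ⟨?_, fun S _ => S.eq_empty_of_isEmpty⟩⟩
  exact ⟨fun v => isEmptyElim v, fun v => isEmptyElim v⟩

theorem numMaxDissociationSets_forestGraph (l : List RTree) :
    numMaxDissociationSets (forestGraph l) = (l.map RTree.count).prod := by
  induction l with
  | nil => exact numMaxDissociationSets_of_isEmpty (V := Empty) _
  | cons t l ih =>
    rw [List.map_cons, List.prod_cons, ← ih, ← t.numMaxDissociationSets_graph]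
    exact numMaxDissociationSets_sum _ _

/-- A graph splits off each of its connected components. -/
noncomputable def sumComponentIso {V : Type*} (G : SimpleGraph V) (c : G.ConnectedComponent) :
    G.induce c.supp ⊕g G.induce c.suppᶜ ≃g G := by
  classical
  refine ⟨Equiv.Set.sumCompl c.supp, ?_⟩
  have h (a : c.supp) (b : (c.suppᶜ : Set V)) : ¬ G.Adj a b := fun h =>
    b.2 ((c.mem_supp_congr_adj h).1 a.2)
  rintro (a | a) (b | b)
  · simp
  · simp [h]
  · simp [G.adj_comm a b, h]
  · simp

theorem exists_forest {V : Type*} [Finite V] (G : SimpleGraph V) (hG : G.IsAcyclic) :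
    ∃ l : List RTree, Nonempty (forestGraph l ≃g G) := by
  classical
  induction h : Nat.card V using Nat.strong_induction_on generalizing V with
  | _ n ih =>
    rcases isEmpty_or_nonempty V with hV | ⟨⟨v⟩⟩
    · exact ⟨[], ⟨⟨Equiv.equivOfIsEmpty Empty V, fun {a} => a.elim⟩⟩⟩
    · have : Fintype V := Fintype.ofFinite V
      set c := G.connectedComponentMk v
      obtain ⟨t, ⟨e⟩⟩ := exists_rtree (G.induce c.supp) (hG.isTree_connectedComponent c)
      obtain ⟨l, ⟨f⟩⟩ := ih (Nat.card (c.suppᶜ : Set V)) (by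
        rw [← h, Nat.card_coe_set_eq, ← Set.ncard_univ]
        exact Set.ncard_lt_ncard (Set.ssubset_univ_iff.2 fun e => by
          have : v ∈ c.suppᶜ := e ▸ Set.mem_univ v
          exact this rfl)) (G.induce c.suppᶜ) (hG.induce _) rfl
      exact ⟨t :: l, ⟨(sumComponentIso G c).comp (Iso.sumCongr e f)⟩⟩

theorem nonempty_iso_of_perm {l l' : List RTree} (h : l.Perm l') :
    Nonempty (forestGraph l ≃g forestGraph l') := by
  induction h with
  | nil => exact ⟨Iso.refl⟩
  | cons t _ ih => exact ih.map fun e => Iso.sumCongr (Iso.refl (G := t.graph)) e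
  | swap s t l =>
    exact ⟨Iso.sumAssoc.comp ((Iso.sumCongr Iso.sumComm Iso.refl).comp Iso.sumAssoc.symm)⟩
  | trans _ _ ih ih' => obtain ⟨e⟩ := ih; obtain ⟨f⟩ := ih'; exact ⟨f.comp e⟩

def sumEmptyIso {V W : Type*} [IsEmpty V] (G : SimpleGraph V) (H : SimpleGraph W) :
    G ⊕g H ≃g H where
  toEquiv := Equiv.emptySum V W
  map_rel_iff' := by
    rintro (a | a) (b | b) <;> first | exact isEmptyElim a | exact isEmptyElim b | exact Iff.rfl

theorem nonempty_iso_append (l l' : List RTree) :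
    Nonempty (forestGraph (l ++ l') ≃g forestGraph l ⊕g forestGraph l') := by
  induction l with
  | nil => exact ⟨(@sumEmptyIso Empty _ _ _ _).symm⟩
  | cons t l ih =>
    exact ih.map fun e => Iso.sumAssoc.symm.comp (Iso.sumCongr (Iso.refl (G := t.graph)) e)

def disjointCopiesSucc {V : Type*} (k : ℕ) (G : SimpleGraph V) :
    G ⊕g disjointCopies k G ≃g disjointCopies (k + 1) G where
  toFun := Sum.elim (fun v => (0, v)) (fun x => (x.1.succ, x.2))
  invFun x := Fin.cases (motive := fun _ => V ⊕ (Fin k × V)) (.inl x.2) (fun i => .inr (i, x.2)) x.1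
  left_inv := by rintro (v | ⟨i, v⟩) <;> rfl
  right_inv := by rintro ⟨i, v⟩; cases i using Fin.cases <;> rfl
  map_rel_iff' := by
    rintro (a | ⟨i, a⟩) (b | ⟨j, b⟩) <;>
      simp [disjointCopies, Fin.succ_ne_zero, (Fin.succ_ne_zero _).symm]

theorem nonempty_iso_disjointCopies {V : Type*} {G : SimpleGraph V} {l : List RTree}
    (h : ∀ t ∈ l, Nonempty (t.graph ≃g G)) :
    Nonempty (forestGraph l ≃g disjointCopies l.length G) := by
  induction l with
  | nil =>
    have : IsEmpty (Fin (List.length ([] : List RTree)) × V) := ⟨fun x => x.1.elim0⟩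
    exact ⟨⟨Equiv.equivOfIsEmpty Empty _, fun {a} => a.elim⟩⟩
  | cons t l ih =>
    obtain ⟨e⟩ := h t (List.mem_cons_self ..)
    obtain ⟨f⟩ := ih fun s hs => h s (List.mem_cons_of_mem _ hs)
    exact ⟨(disjointCopiesSucc _ _).comp (Iso.sumCongr e f)⟩

theorem numMaxDissociationSets_disjointCopies {V : Type*} (k : ℕ) (G : SimpleGraph V) :
    numMaxDissociationSets (disjointCopies k G) = numMaxDissociationSets G ^ k := by
  induction k with
  | zero =>
    have : IsEmpty (Fin 0 × V) := ⟨fun x => x.1.elim0⟩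
    exact numMaxDissociationSets_of_isEmpty _
  | succ k ih =>
    rw [← numMaxDissociationSets_congr (disjointCopiesSucc k G), numMaxDissociationSets_sum, ih,
      pow_succ, mul_comm]
end Dissociation

namespace Dissociation
open SimpleGraph

namespace RTree

/-! ### Hubs -/

/-- The root with `k` cherries attached. -/
def cherryHub : ℕ → RTree
  | 0 => single
  | k + 1 => attach (cherryHub k) cherry

/-- Here `i` counts the branches attached at their middle vertex and `j` those attached at an end.
The total is 3 ^ (i + j) + i, so each branch attached at an end costs exactly 1. -/
theorem profile_of_isHub {h : RTree} (hh : h.isHub = true) : ∃ i j, h.size = 3 * (i + j) + 1 ∧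
    h.profile.blk + 1 + j = 3 ^ (i + j) ∧ h.profile.bare = 1 ∧ h.profile.half = j ∧
    h.profile.lone = 1 ∧ h.profile.pair = i + j ∧ h.profile.soft = 1 ∧
    (j = 0 → h = cherryHub i) := by
  induction h with
  | single => exact ⟨0, 0, rfl, rfl, rfl, rfl, rfl, rfl, rfl, fun _ => rfl⟩
  | attach x y hx _ =>
    rw [isHub_attach] at hh
    obtain ⟨i, j, h1, h2, h3, h4, h5, h6, h7, h8⟩ := hx hh.1
    rcases eq_of_size_eq_three y hh.2 with rfl | rfl
    · refine ⟨i + 1, j, ?_⟩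
      have e : cherry.profile = ⟨1, 0, 0, 0, 2, 1⟩ := rfl
      simp only [size, profile, e, Profile.attach, Profile.total, Profile.del, h3, h4, h5, h6, h7,
        hh.2]
      refine ⟨by lia, ?_, by lia, by lia, by lia, by lia, by lia, ?_⟩
      · rw [show i + 1 + j = i + j + 1 by omega, pow_succ, ← h2]; ring
      · intro h0; rw [h8 h0]; rfl
    · refine ⟨i, j + 1, ?_⟩
      have e : path3.profile = ⟨1, 0, 0, 1, 1, 1⟩ := rfl
      simp only [size, profile, e, Profile.attach, Profile.total, Profile.del, h3, h4, h5, h6, h7,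
        hh.2]
      refine ⟨by lia, ?_, by lia, by lia, by lia, by lia, by lia, by lia⟩
      rw [← add_assoc i, pow_succ, ← h2]; ring

theorem count_of_isHub {h : RTree} (hh : h.isHub = true) {k : ℕ} (hk : h.size = 3 * k + 1) :
    h.count ≤ 3 ^ k + k ∧ (h.count = 3 ^ k + k → h = cherryHub k) := by
  obtain ⟨i, j, h1, h2, h3, h4, h5, h6, h7, h8⟩ := profile_of_isHub hh
  obtain rfl : k = i + j := by omega
  have : h.count = h.profile.blk + h.profile.lone + h.profile.pair := rfl
  refine ⟨by omega, fun h' => ?_⟩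
  have : j = 0 := by omega
  subst this
  exact h8 rfl

theorem profile_cherryHub (k : ℕ) : (cherryHub k).profile = ⟨3 ^ k - 1, 1, 0, 1, k, 1⟩ := by
  induction k with
  | zero => rfl
  | succ k ih =>
    have e : cherry.profile = ⟨1, 0, 0, 0, 2, 1⟩ := rfl
    have : 0 < 3 ^ k := by positivity
    simp only [cherryHub, profile, e, Profile.attach, Profile.total, Profile.del, ih,
      Profile.mk.injEq, pow_succ]
    lia

theorem count_cherryHub (k : ℕ) : (cherryHub k).count = 3 ^ k + k := by
  have : 0 < 3 ^ k := by positivity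
  simp only [count, profile_cherryHub, Profile.total]
  omega

end RTree

/-! ### The extremal graphs as rooted trees -/

open RTree

/-- The star with `r` leaves, rooted at its centre. -/
def starTree : ℕ → RTree
  | 0 => single
  | r + 1 => attach (starTree r) single

def starKSucc (r : ℕ) :
    joinRoots (starK r) (⊥ : SimpleGraph Unit) (.inl 0) () ≃g starK (r + 1) where
  toFun := Sum.elim (Sum.elim .inl fun i => .inr i.succ) fun _ => .inr 0
  invFun := Sum.elim (fun i => .inl (.inl i)) fun i =>
    Fin.cases (motive := fun _ => (Fin 1 ⊕ Fin r) ⊕ Unit) (.inr ()) (fun i => .inl (.inr i)) i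
  left_inv := by rintro ((a | a) | ⟨⟩) <;> rfl
  right_inv := by
    rintro (a | a)
    · rfl
    · cases a using Fin.cases <;> rfl
  map_rel_iff' := by
    rintro ((a | a) | ⟨⟩) ((b | b) | ⟨⟩) <;> simp [Subsingleton.elim _ (0 : Fin 1)]

theorem exists_iso_starTree (r : ℕ) :
    ∃ e : (starTree r).graph ≃g starK r, e (starTree r).root = .inl 0 := by
  induction r with
  | zero =>
    refine ⟨⟨⟨fun _ => .inl 0, fun _ => (), fun _ => rfl, ?_⟩, ?_⟩, rfl⟩
    · rintro (a | a)
      · rw [Subsingleton.elim a 0]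
      · exact a.elim0
    · intro a b
      exact iff_of_false (fun h => SimpleGraph.irrefl _ h) (fun h => h)
  | succ r ih =>
    obtain ⟨e, he⟩ := ih
    refine ⟨(starKSucc r).comp (joinCongr e (Iso.refl (G := (⊥ : SimpleGraph Unit))) he rfl), ?_⟩
    exact congrArg (fun z => starKSucc r (Sum.inl z)) he

def starKTwoIso : starK 2 ≃g pathP3 where
  toFun := Sum.elim (fun _ => 1) ![0, 2]
  invFun := ![.inr 0, .inl 0, .inr 1]
  left_inv := by decide
  right_inv := by decide
  map_rel_iff' := by
    have : ∀ a b : Fin 1 ⊕ Fin 2,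
        ((Sum.elim (fun _ => 1) ![0, 2] a : Fin 3).val + 1 =
          (Sum.elim (fun _ => 1) ![0, 2] b : Fin 3).val ∨
        (Sum.elim (fun _ => 1) ![0, 2] b : Fin 3).val + 1 =
          (Sum.elim (fun _ => 1) ![0, 2] a : Fin 3).val) ↔
        (a.isLeft ∧ b.isRight ∨ a.isRight ∧ b.isLeft) := by decide
    intro a b
    rw [pathGraph_adj]
    exact this a b

theorem exists_iso_cherry : ∃ e : cherry.graph ≃g pathP3, e cherry.root = 1 := by
  obtain ⟨e, he⟩ := exists_iso_starTree 2
  exact ⟨starKTwoIso.comp e, congrArg starKTwoIso he⟩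

theorem nonempty_iso_path3 : Nonempty (path3.graph ≃g pathP3) := by
  have h : cherry ∈ path3.rootings := by decide
  obtain ⟨e, -⟩ := exists_iso_cherry
  obtain ⟨f⟩ := nonempty_iso_of_mem_rootings h
  exact ⟨e.comp f.symm⟩

theorem nonempty_iso_treeTStar8 :
    Nonempty (((single.attach cherry).attach (single.attach cherry)).graph ≃g treeTStar8) := by
  obtain ⟨e, he⟩ := exists_iso_starTree 2
  let g : (single.attach cherry).graph ≃g joinRoots (⊥ : SimpleGraph Unit) (starK 2) () (Sum.inl 0) :=
    joinCongr (Iso.refl (G := single.graph)) e rfl he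
  let f : (single.attach cherry).graph ≃g starK 3 :=
    (starKSucc 2).comp ((joinSwap () (Sum.inl 0)).comp g)
  have hf : f (single.attach cherry).root = .inr 0 := rfl
  refine ⟨Iso.comp ?_ (joinCongr f f hf hf)⟩
  refine ⟨Equiv.refl _, ?_⟩
  rintro ((a | a) | (a | a)) ((b | b) | (b | b)) <;>
    simp [treeTStar8, edge_adj, and_comm]

/-- The tree `treeTStar (3 * k + 1)`. -/
def cherryTree (k : ℕ) : SimpleGraph ((Fin k × Fin 3) ⊕ Unit) :=
  (disjointCopies k pathP3 ⊕g (⊥ : SimpleGraph Unit)) ⊔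
    SimpleGraph.fromRel (fun x y => ∃ i : Fin k, x = Sum.inl (i, 1) ∧ y = Sum.inr ())

def cherryTreeSucc (k : ℕ) :
    joinRoots (cherryTree k) pathP3 (.inr ()) 1 ≃g cherryTree (k + 1) where
  toFun := Sum.elim (Sum.elim (fun x => .inl (x.1.succ, x.2)) .inr) fun v => .inl (0, v)
  invFun := Sum.elim (fun x => Fin.cases (motive := fun _ => ((Fin k × Fin 3) ⊕ Unit) ⊕ Fin 3)
    (.inr x.2) (fun i => .inl (.inl (i, x.2))) x.1) fun u => .inl (.inr u)
  left_inv := by rintro ((a | a) | a) <;> rfl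
  right_inv := by
    rintro (⟨i, v⟩ | ⟨⟩)
    · cases i using Fin.cases <;> rfl
    · rfl
  map_rel_iff' := by
    rintro ((⟨i, a⟩ | ⟨⟩) | a) ((⟨j, b⟩ | ⟨⟩) | b) <;>
      simp [cherryTree, disjointCopies, Fin.succ_ne_zero, (Fin.succ_ne_zero _).symm]

theorem exists_iso_cherryTree (k : ℕ) :
    ∃ e : (cherryHub k).graph ≃g cherryTree k, e (cherryHub k).root = .inr () := by
  induction k with
  | zero =>
    refine ⟨⟨⟨fun _ => .inr (), fun _ => (), fun _ => rfl, ?_⟩, ?_⟩, rfl⟩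
    · rintro (⟨i, -⟩ | ⟨⟩)
      · exact i.elim0
      · rfl
    · intro a b
      exact iff_of_false (fun h => SimpleGraph.irrefl _ h) (fun h => h)
  | succ k ih =>
    obtain ⟨e, he⟩ := ih
    obtain ⟨f, hf⟩ := exists_iso_cherry
    refine ⟨(cherryTreeSucc k).comp (joinCongr e f he hf), ?_⟩
    exact congrArg (fun z => cherryTreeSucc k (Sum.inl z)) he

theorem nonempty_iso_treeTStar (n : ℕ) :
    Nonempty ((cherryHub ((n - 1) / 3)).graph ≃g treeTStar n) :=
  let ⟨e, _⟩ := exists_iso_cherryTree ((n - 1) / 3)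
  ⟨e⟩

theorem numMaxDissociationSets_treeTStar (n : ℕ) :
    numMaxDissociationSets (treeTStar n) = 3 ^ ((n - 1) / 3) + (n - 1) / 3 := by
  obtain ⟨e⟩ := nonempty_iso_treeTStar n
  rw [← numMaxDissociationSets_congr e, numMaxDissociationSets_graph, count_cherryHub]

theorem numMaxDissociationSets_pathP3 : numMaxDissociationSets pathP3 = 3 := by
  obtain ⟨e, -⟩ := exists_iso_cherry
  rw [← numMaxDissociationSets_congr e, numMaxDissociationSets_graph]
  rfl

theorem numMaxDissociationSets_starK (r : ℕ) :
    numMaxDissociationSets (starK r) = (starTree r).count := by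
  obtain ⟨e, -⟩ := exists_iso_starTree r
  rw [← numMaxDissociationSets_congr e, numMaxDissociationSets_graph]

theorem numMaxDissociationSets_treeTStar8 : numMaxDissociationSets treeTStar8 = 15 := by
  obtain ⟨e⟩ := nonempty_iso_treeTStar8
  rw [← numMaxDissociationSets_congr e, numMaxDissociationSets_graph]
  rfl

/-! ### Uniqueness of the extremal trees -/

theorem iso_of_size_three (t : RTree) (ht : t.size = 3) :
    Nonempty (t.graph ≃g pathP3) ∧ t.count = 3 := by
  rcases eq_of_size_eq_three t ht with rfl | rfl
  · exact ⟨exists_iso_cherry.nonempty, rfl⟩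
  · exact ⟨nonempty_iso_path3, rfl⟩

theorem iso_of_mem_rootings {V : Type*} {G : SimpleGraph V} {t h : RTree}
    (hh : (t.rootings.contains h) = true) (e : Nonempty (h.graph ≃g G)) :
    Nonempty (t.graph ≃g G) := by
  obtain ⟨f⟩ := nonempty_iso_of_mem_rootings (List.contains_iff_mem.1 hh)
  obtain ⟨e⟩ := e
  exact ⟨e.comp f.symm⟩

/-- This turns uniqueness of an extremal tree into a finite computation. Membership in `rootings`
compares trees with ordered children, so `l` has to contain enough orderings of the extremal tree.
-/
theorem le_or_iso_of_forallOfSize {V : Type*} {G : SimpleGraph V} {n c d : ℕ} {l : List RTree}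
    (e : ∀ h ∈ l, Nonempty (h.graph ≃g G)) (hf : forallOfSize n n (fun t => Nat.ble t.count c ||
      Nat.beq t.count d && l.any t.rootings.contains) = true) (t : RTree) (ht : t.size = n) :
    t.count ≤ c ∨ t.count = d ∧ Nonempty (t.graph ≃g G) := by
  have := of_forallOfSize hf le_rfl t ht
  simp only [Bool.or_eq_true, Bool.and_eq_true, Nat.ble_eq, Nat.beq_eq, List.any_eq_true] at this
  exact this.imp_right fun ⟨h1, h, hl, h2⟩ => ⟨h1, iso_of_mem_rootings h2 (e h hl)⟩

theorem iso_of_size_four (t : RTree) (ht : t.size = 4) :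
    t.count ≤ 3 ∨ t.count = 4 ∧ Nonempty (t.graph ≃g starK 3) :=
  le_or_iso_of_forallOfSize (List.forall_mem_singleton.2 (exists_iso_starTree 3).nonempty) (by decide +kernel) t ht

theorem iso_of_size_five (t : RTree) (ht : t.size = 5) :
    t.count ≤ 4 ∨ t.count = 5 ∧ Nonempty (t.graph ≃g starK 4) :=
  le_or_iso_of_forallOfSize (List.forall_mem_singleton.2 (exists_iso_starTree 4).nonempty) (by decide +kernel) t ht

theorem iso_of_size_seven (t : RTree) (ht : t.size = 7) :
    t.count ≤ 10 ∨ t.count = 11 ∧ Nonempty (t.graph ≃g treeTStar 7) :=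
  le_or_iso_of_forallOfSize (List.forall_mem_singleton.2 (nonempty_iso_treeTStar 7)) (by decide +kernel) t ht

/-- Rooted at an end of the middle edge, `treeTStar8` has two different branches at the root, hence
two orderings, and both are listed. -/
theorem iso_of_size_eight (t : RTree) (ht : t.size = 8) :
    t.count ≤ 14 ∨ t.count = 15 ∧ Nonempty (t.graph ≃g treeTStar8) :=
  le_or_iso_of_forallOfSize (List.forall_mem_cons.2 ⟨nonempty_iso_treeTStar8,
    List.forall_mem_singleton.2 (nonempty_iso_treeTStar8.map fun e =>
      e.comp (equivalent_attach_attach single (single.attach cherry) cherry).choose)⟩)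
    (by decide +kernel) t ht

theorem count_of_starlike {t : RTree} (ht : t.starlike = true) : ∃ k, t.size = 3 * k + 1 ∧
    t.count ≤ 3 ^ k + k ∧
      (t.count = 3 ^ k + k → Nonempty (t.graph ≃g treeTStar (3 * k + 1))) := by
  obtain ⟨h, hh, hhub⟩ := starlike_iff.1 ht
  have hs := size_of_mem_rootings hh
  have hc := count_of_mem_rootings hh
  have hm := size_mod_of_isHub hhub
  obtain ⟨k, hk⟩ : ∃ k, h.size = 3 * k + 1 := ⟨h.size / 3, by omega⟩
  obtain ⟨h1, h2⟩ := count_of_isHub hhub hk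
  rw [hc] at h1 h2
  refine ⟨k, by omega, h1, fun h' => ?_⟩
  obtain ⟨e⟩ := nonempty_iso_of_mem_rootings hh
  have hk' : h = cherryHub ((3 * k + 1 - 1) / 3) := by
    rw [show (3 * k + 1 - 1) / 3 = k by omega, h2 h']
  have f := nonempty_iso_treeTStar (3 * k + 1)
  rw [← hk'] at f
  exact f.map fun f => f.comp e.symm
end Dissociation

namespace Dissociation
open SimpleGraph RTree

/-! ### The bound for trees -/

theorem treeBound_of_mod {n k : ℕ} (h : n = 3 * k + 1) : treeBound n = ((3 ^ k + k : ℕ) : ℝ) := by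
  subst h
  have h : (((3 * k + 1 : ℕ) : ℝ) - 1) / 3 = k := by push_cast; ring
  rw [treeBound, h, Real.rpow_natCast]
  push_cast
  rfl

/-- The integer `p` is a lower estimate for three times the power in `treeBound`, namely 3 ^ ((n +
2) / 3), so the comparison needs no real powers. -/
theorem lt_treeBound {c n p : ℕ} (h : 3 * c + 1 ≤ p + n) (hp : p ^ 3 < 3 ^ (n + 2)) :
    (c : ℝ) < treeBound n := by
  set x : ℝ := (3 : ℝ) ^ (((n : ℝ) - 1) / 3) with hx
  have hx0 : 0 < x := by positivity
  have hx3 : (3 * x) ^ 3 = 3 ^ (n + 2) := by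
    rw [mul_pow, hx, ← Real.rpow_natCast, ← Real.rpow_natCast ((3 : ℝ) ^ _) 3, ← Real.rpow_mul
      (by norm_num), ← Real.rpow_natCast, ← Real.rpow_add (by norm_num)]
    congr 1
    push_cast
    ring
  have hlt : (p : ℝ) < 3 * x := by
    refine lt_of_pow_lt_pow_left₀ 3 (by positivity) ?_
    rw [hx3]
    exact_mod_cast hp
  have h' : 3 * (c : ℝ) + 1 ≤ p + n := by exact_mod_cast h
  rw [treeBound, ← hx]
  linarith

theorem lt_treeBound_of_cube_le {c n : ℕ} (hn : 2 ≤ n) (h : c ^ 3 ≤ 3 ^ (n - 1)) :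
    (c : ℝ) < treeBound n := by
  refine lt_treeBound (p := 3 * c - 1) (by omega) ?_
  obtain ⟨m, rfl⟩ : ∃ m, n = m + 1 := ⟨n - 1, by omega⟩
  rw [Nat.add_sub_cancel] at h
  rcases Nat.eq_zero_or_pos c with rfl | hc
  · simp
  · calc (3 * c - 1) ^ 3 < (3 * c) ^ 3 := Nat.pow_lt_pow_left (by omega) (by norm_num)
      _ = 3 ^ 3 * c ^ 3 := mul_pow _ _ _
      _ ≤ 3 ^ 3 * 3 ^ m := Nat.mul_le_mul_left _ h
      _ = 3 ^ (m + 1 + 2) := by ring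

theorem starlike_or_lt_treeBound (t : RTree) (ht : 4 ≤ t.size) :
    t.starlike = true ∨ (t.count : ℝ) < treeBound t.size := by
  have key {n c p : ℕ} (hs : t.size = n) (hc : t.count ≤ c) (h : 3 * c + 1 ≤ p + n)
      (hp : p ^ 3 < 3 ^ (n + 2)) : t.starlike = true ∨ (t.count : ℝ) < treeBound t.size :=
    Or.inr (hs ▸ lt_treeBound (by omega) hp)
  have small {n c p : ℕ} (hs : t.size = n) (hn : n ≤ 9) (hc : smallMax n = c)
      (h : 3 * c + 1 ≤ p + n) (hp : p ^ 3 < 3 ^ (n + 2)) :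
      t.starlike = true ∨ (t.count : ℝ) < treeBound t.size :=
    key hs (hc ▸ hs ▸ count_le_smallMax t (by omega)) h hp
  rcases (by omega : t.size = 4 ∨ t.size = 5 ∨ t.size = 6 ∨ t.size = 8 ∨ t.size = 9 ∨
    (t.size = 7 ∨ 10 ≤ t.size)) with h | h | h | h | h | h
  · exact Or.inl (starlike_of_size_eq_four t h)
  -- In all numerical cases `p` is 3 * c + 1 - n, the least value that `lt_treeBound` permits.
  · exact small (p := 11) h (by norm_num) rfl (by norm_num [smallMax]) (by norm_num)
  · exact small (p := 13) h (by norm_num) rfl (by norm_num [smallMax]) (by norm_num)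
  · exact small (p := 38) h (by norm_num) rfl (by norm_num [smallMax]) (by norm_num)
  · exact small (p := 49) h (by norm_num) rfl (by norm_num [smallMax]) (by norm_num)
  · rcases starlike_or_bounded t h with h' | h'
    · exact Or.inl h'
    rcases h' with ⟨h1, h2⟩ | ⟨h1, h2⟩ | ⟨h1, h2⟩ | ⟨-, -, -, h2⟩
    · exact key (p := 116) h1 h2 (by norm_num) (by norm_num)
    · exact key (p := 166) h1 h2 (by norm_num) (by norm_num)
    · exact key (p := 338) h1 h2 (by norm_num) (by norm_num)
    · exact Or.inr (lt_treeBound_of_cube_le (by omega) h2)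

theorem numMaxDissociationSets_tree {n : ℕ} {V : Type*} [Fintype V] (T : SimpleGraph V)
    (hn : 4 ≤ n) (hV : Fintype.card V = n) (hT : T.IsTree) :
    (numMaxDissociationSets T : ℝ) ≤ treeBound n ∧
      ((numMaxDissociationSets T : ℝ) = treeBound n ↔
        n % 3 = 1 ∧ Nonempty (T ≃g treeTStar n)) := by
  obtain ⟨t, ⟨e⟩⟩ := exists_rtree T hT
  have hs : t.size = n := by rw [← t.card_V, ← hV]; exact Fintype.card_congr e.toEquiv
  have hc : numMaxDissociationSets T = t.count := by
    rw [← numMaxDissociationSets_congr e, t.numMaxDissociationSets_graph]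
  have hback : n % 3 = 1 ∧ Nonempty (T ≃g treeTStar n) →
      (numMaxDissociationSets T : ℝ) = treeBound n := by
    rintro ⟨h, ⟨f⟩⟩
    rw [numMaxDissociationSets_congr f, numMaxDissociationSets_treeTStar,
      treeBound_of_mod (k := (n - 1) / 3) (by omega)]
  rcases starlike_or_lt_treeBound t (hs ▸ hn) with h | h
  · obtain ⟨k, h1, h2, h3⟩ := count_of_starlike h
    obtain rfl : n = 3 * k + 1 := by omega
    refine ⟨?_, fun h' => ⟨by omega, ?_⟩, hback⟩
    · rw [treeBound_of_mod rfl, hc]; exact_mod_cast h2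
    · rw [treeBound_of_mod rfl, hc] at h'
      obtain ⟨f⟩ := h3 (by exact_mod_cast h')
      exact ⟨f.comp e.symm⟩
  · rw [hs, ← hc] at h
    exact ⟨h.le, fun h' => absurd h' h.ne, hback⟩

/-! ### The bound for forests -/

/-- The order of the forest `forestGraph l`. -/
def orderSum (l : List RTree) : ℕ := (l.map RTree.size).sum

/-- The number of maximal dissociation sets of the forest `forestGraph l`. -/
def countProd (l : List RTree) : ℕ := (l.map RTree.count).prod

@[simp] theorem orderSum_nil : orderSum [] = 0 := rfl
@[simp] theorem countProd_nil : countProd [] = 1 := rfl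
@[simp] theorem orderSum_cons (t : RTree) (l : List RTree) :
    orderSum (t :: l) = t.size + orderSum l := by simp [orderSum]
@[simp] theorem countProd_cons (t : RTree) (l : List RTree) :
    countProd (t :: l) = t.count * countProd l := by simp [countProd]

/-- The order and the count of `K_{1,4}`, `treeTStar 7` and `treeTStar8`. -/
def IsLarge (t : RTree) : Prop :=
  t.size = 5 ∧ t.count = 5 ∨ t.size = 7 ∧ t.count = 11 ∨ t.size = 8 ∧ t.count = 15

/-- The constant 23/50 lies between 1000/2187, which bounds the weight of starlike trees of order at
least 10, and (64/81) ^ 3, the weight of three K_{1,3}. -/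
theorem classify (t : RTree) (h3 : t.size ≠ 3) : (t.size = 4 ∧ t.count = 4) ∨ IsLarge t ∨
    50 * t.count ^ 3 ≤ 23 * 3 ^ t.size := by
  have key {n c : ℕ} (hs : t.size = n) (hc : t.count ≤ c) (h : 50 * c ^ 3 ≤ 23 * 3 ^ n) :
      50 * t.count ^ 3 ≤ 23 * 3 ^ t.size :=
    hs ▸ (Nat.mul_le_mul_left _ (Nat.pow_le_pow_left hc 3)).trans h
  have small {n c : ℕ} (hs : t.size = n) (hn : n ≤ 9) (hc : smallMax n = c)
      (h : 50 * c ^ 3 ≤ 23 * 3 ^ n) : 50 * t.count ^ 3 ≤ 23 * 3 ^ t.size :=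
    key hs (hc ▸ hs ▸ count_le_smallMax t (by omega)) h
  have hpos := t.size_pos
  rcases (by omega : t.size = 1 ∨ t.size = 2 ∨ t.size = 4 ∨ t.size = 5 ∨ t.size = 6 ∨
    t.size = 7 ∨ t.size = 8 ∨ t.size = 9 ∨ 10 ≤ t.size) with
    h | h | h | h | h | h | h | h | h
  · exact Or.inr (Or.inr (small h (by norm_num) rfl (by norm_num [smallMax])))
  · exact Or.inr (Or.inr (small h (by norm_num) rfl (by norm_num [smallMax])))
  · rcases iso_of_size_four t h with h' | ⟨h', -⟩
    · exact Or.inr (Or.inr (key h h' (by norm_num)))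
    · exact Or.inl ⟨h, h'⟩
  · rcases iso_of_size_five t h with h' | ⟨h', -⟩
    · exact Or.inr (Or.inr (key h h' (by norm_num)))
    · exact Or.inr (Or.inl (Or.inl ⟨h, h'⟩))
  · exact Or.inr (Or.inr (small h (by norm_num) rfl (by norm_num [smallMax])))
  · rcases iso_of_size_seven t h with h' | ⟨h', -⟩
    · exact Or.inr (Or.inr (key h h' (by norm_num)))
    · exact Or.inr (Or.inl (Or.inr (Or.inl ⟨h, h'⟩)))
  · rcases iso_of_size_eight t h with h' | ⟨h', -⟩
    · exact Or.inr (Or.inr (key h h' (by norm_num)))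
    · exact Or.inr (Or.inl (Or.inr (Or.inr ⟨h, h'⟩)))
  · exact Or.inr (Or.inr (small h (by norm_num) rfl (by norm_num [smallMax])))
  · right; right
    rcases starlike_or_bounded t (Or.inr h) with h' | h'
    · obtain ⟨k, h1, h2, -⟩ := count_of_starlike h'
      obtain ⟨j, rfl⟩ : ∃ j, k = j + 3 := ⟨k - 3, by omega⟩
      -- Thus 3 ^ k + k is at most 10/9 of 3 ^ k for k ≥ 3, and the weight is at most (10/9) ^ 3 / 3
      -- = 1000/2187.
      have hj : 9 * (j + 3) ≤ 3 ^ (j + 3) := by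
        clear h1 h2
        induction j with
        | zero => norm_num
        | succ j ih => rw [show j + 1 + 3 = j + 3 + 1 from rfl, pow_succ]; omega
      have h4 : 9 * t.count ≤ 10 * 3 ^ (j + 3) := by omega
      have h5 := Nat.pow_le_pow_left h4 3
      rw [mul_pow, mul_pow, ← pow_mul] at h5
      rw [h1, pow_succ 3 (3 * _), mul_comm 3 (j + 3)]
      omega
    · rcases h' with ⟨h1, h2⟩ | ⟨h1, h2⟩ | ⟨h1, h2⟩ | ⟨-, -, -, h2⟩
      · exact key h1 h2 (by norm_num)
      · exact key h1 h2 (by norm_num)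
      · exact key h1 h2 (by norm_num)
      · obtain ⟨m, hm⟩ : ∃ m, t.size = m + 1 := ⟨t.size - 1, by omega⟩
        rw [hm, Nat.add_sub_cancel] at h2
        rw [hm, pow_succ 3]
        omega

theorem of_forall_size_eq_four {l : List RTree} (h : ∀ t ∈ l, t.size = 4 ∧ t.count = 4) :
    orderSum l = 4 * l.length ∧ countProd l = 4 ^ l.length := by
  induction l with
  | nil => exact ⟨rfl, rfl⟩
  | cons t l ih =>
    obtain ⟨h1, h2⟩ := ih fun s hs => h s (List.mem_cons_of_mem _ hs)
    obtain ⟨h3, h4⟩ := h t List.mem_cons_self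
    simp only [orderSum_cons, countProd_cons, h1, h2, h3, h4, List.length_cons, pow_succ]
    omega

theorem of_forall_size_eq_three {l : List RTree} (h : ∀ t ∈ l, t.size = 3) :
    orderSum l = 3 * l.length ∧ countProd l = 3 ^ l.length := by
  induction l with
  | nil => exact ⟨rfl, rfl⟩
  | cons t l ih =>
    obtain ⟨h1, h2⟩ := ih fun s hs => h s (List.mem_cons_of_mem _ hs)
    have h3 := h t List.mem_cons_self
    simp only [orderSum_cons, countProd_cons, h1, h2, h3, (iso_of_size_three t h3).2,
      List.length_cons, pow_succ]
    omega

/-- Lists of trees for which `countProd l ^ 3 / 3 ^ orderSum l` is smaller than it is for three stars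
`K_{1,3}`. -/
def IsSmall (l : List RTree) : Prop := 531441 * countProd l ^ 3 < 262144 * 3 ^ orderSum l

/-- The lists of trees without trees of order `3` for which `countProd l ^ 3 / 3 ^ orderSum l` is at
least as large as it is for three stars `K_{1,3}`. -/
theorem isSmall_or (l : List RTree) (h3 : ∀ t ∈ l, t.size ≠ 3) :
    (l.length ≤ 3 ∧ ∀ t ∈ l, t.size = 4 ∧ t.count = 4) ∨ (∃ t, l = [t] ∧ IsLarge t) ∨
      IsSmall l := by
  induction l with
  | nil => exact Or.inl ⟨by simp, by simp⟩
  | cons t l ih =>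
    have hl := ih fun s hs => h3 s (List.mem_cons_of_mem _ hs)
    have num {p m : ℕ} (h1 : countProd l = p) (h2 : orderSum l = m)
        (h : 531441 * (t.count * p) ^ 3 < 262144 * 3 ^ (t.size + m)) : IsSmall (t :: l) := by
      rw [IsSmall, orderSum_cons, countProd_cons, h1, h2]; exact h
    have mult (ht : t.count ^ 3 ≤ 3 ^ t.size) (h : IsSmall l) : IsSmall (t :: l) := by
      rw [IsSmall] at h ⊢
      rw [orderSum_cons, countProd_cons, mul_pow, pow_add]
      calc 531441 * (t.count ^ 3 * countProd l ^ 3)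
          = t.count ^ 3 * (531441 * countProd l ^ 3) := by ring
        _ ≤ 3 ^ t.size * (531441 * countProd l ^ 3) := Nat.mul_le_mul_right _ ht
        _ < 3 ^ t.size * (262144 * 3 ^ orderSum l) := Nat.mul_lt_mul_of_pos_left h (by positivity)
        _ = _ := by ring
    rcases classify t (h3 t List.mem_cons_self) with ht | ht | ht
    · rcases hl with ⟨hlen, hl⟩ | ⟨s, rfl, hs⟩ | hl
      · rcases Nat.lt_or_ge l.length 3 with h | h
        · exact Or.inl ⟨h, List.forall_mem_cons.2 ⟨ht, hl⟩⟩
        · obtain ⟨h1, h2⟩ := of_forall_size_eq_four hl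
          rw [show l.length = 3 by omega] at h1 h2
          exact Or.inr (Or.inr (num h2 h1 (by rw [ht.1, ht.2]; norm_num)))
      · right; right
        rcases hs with ⟨h1, h2⟩ | ⟨h1, h2⟩ | ⟨h1, h2⟩ <;>
          exact num (p := s.count) (m := s.size) (by simp) (by simp)
            (by rw [ht.1, ht.2, h1, h2]; norm_num)
      · exact Or.inr (Or.inr (mult (by rw [ht.1, ht.2]; norm_num) hl))
    · rcases hl with ⟨hlen, hl⟩ | ⟨s, rfl, hs⟩ | hl
      · rcases Nat.eq_zero_or_pos l.length with h | h
        · exact Or.inr (Or.inl ⟨t, by rw [List.length_eq_zero_iff.1 h], ht⟩)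
        · right; right
          obtain ⟨h1, h2⟩ := of_forall_size_eq_four hl
          refine num h2 h1 ?_
          generalize l.length = k at *
          rcases ht with ⟨h1, h2⟩ | ⟨h1, h2⟩ | ⟨h1, h2⟩ <;> rw [h1, h2] <;>
            interval_cases k <;> norm_num
      · right; right
        refine num (p := s.count) (m := s.size) (by simp) (by simp) ?_
        rcases hs with ⟨h1, h2⟩ | ⟨h1, h2⟩ | ⟨h1, h2⟩ <;>
          rcases ht with ⟨h3, h4⟩ | ⟨h3, h4⟩ | ⟨h3, h4⟩ <;> rw [h1, h2, h3, h4] <;> norm_num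
      · refine Or.inr (Or.inr (mult ?_ hl))
        rcases ht with ⟨h1, h2⟩ | ⟨h1, h2⟩ | ⟨h1, h2⟩ <;> rw [h1, h2] <;> norm_num
    -- A tree of weight at most 23/50 is already below the threshold, so for the rest it is enough
    -- that the weight does not exceed 1.
    · have weak : countProd l ^ 3 ≤ 3 ^ orderSum l := by
        rcases hl with ⟨hlen, hl⟩ | ⟨s, rfl, hs⟩ | hl
        · obtain ⟨h1, h2⟩ := of_forall_size_eq_four hl
          rw [h1, h2, ← pow_mul, mul_comm, pow_mul, pow_mul]
          exact Nat.pow_le_pow_left (by norm_num) _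
        · simp only [orderSum_cons, countProd_cons, orderSum_nil, countProd_nil, mul_one,
            add_zero]
          rcases hs with ⟨h1, h2⟩ | ⟨h1, h2⟩ | ⟨h1, h2⟩ <;> rw [h1, h2] <;> norm_num
        · rw [IsSmall] at hl; omega
      right; right
      have := Nat.mul_le_mul ht weak
      have hpos : 0 < 3 ^ t.size * 3 ^ orderSum l := by positivity
      rw [IsSmall, orderSum_cons, countProd_cons, mul_pow, pow_add]
      rw [mul_assoc, mul_assoc] at this
      omega
end Dissociation

namespace Dissociation
open SimpleGraph RTree

/-! ### Forests of small order -/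

theorem eq_nil_of_orderSum {l : List RTree} (h : orderSum l = 0) : l = [] := by
  cases l with
  | nil => rfl
  | cons t l => have := t.size_pos; rw [orderSum_cons] at h; omega

/-- The largest values of `countProd l` for `orderSum l ≤ 8`. -/
def smallForestMax (n : ℕ) : ℕ := [1, 1, 1, 3, 4, 5, 9, 12, 16].getD n 0

/-- The table satisfies smallMax s * smallForestMax m ≤ smallForestMax (s + m), so trees can be
split off one at a time. -/
theorem countProd_le (l : List RTree) (h : orderSum l ≤ 8) :
    countProd l ≤ smallForestMax (orderSum l) := by
  induction l with
  | nil => decide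
  | cons t l ih =>
    rw [orderSum_cons] at h ⊢
    rw [countProd_cons]
    have key : ∀ s < 9, ∀ m < 9, s ≠ 0 → s + m ≤ 8 →
        smallMax s * smallForestMax m ≤ smallForestMax (s + m) := by decide
    exact (Nat.mul_le_mul (count_le_smallMax t (by omega)) (ih (by omega))).trans
      (key _ (by omega) _ (by omega) t.size_pos.ne' h)

theorem countProd_cons_le {t : RTree} {l : List RTree} {s m b : ℕ} (hs : t.size = s)
    (hm : orderSum l = m) (hs' : s ≤ 9) (hm' : m ≤ 8) (hb : smallMax s * smallForestMax m ≤ b) :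
    countProd (t :: l) ≤ b := by
  rw [countProd_cons]
  subst hs hm
  exact (Nat.mul_le_mul (count_le_smallMax t hs') (countProd_le l hm')).trans hb

theorem countProd_of_orderSum_three (l : List RTree) (h : orderSum l = 3) :
    countProd l = 3 ∨ countProd l ≤ 1 := by
  cases l with
  | nil => simp at h
  | cons t l =>
    have := t.size_pos
    rw [orderSum_cons] at h
    rcases (by omega : t.size = 1 ∨ t.size = 2 ∨ t.size = 3) with hs | hs | hs
    · have := countProd_cons_le (l := l) (m := 2) (b := 1) hs (by omega) (by decide)
        (by decide) (by decide)
      omega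
    · have := countProd_cons_le (l := l) (m := 1) (b := 1) hs (by omega) (by decide)
        (by decide) (by decide)
      omega
    · rw [eq_nil_of_orderSum (l := l) (by omega), countProd_cons, (iso_of_size_three t hs).2]
      simp

theorem countProd_of_orderSum_four (l : List RTree) (h : orderSum l = 4) :
    countProd l ≤ 3 ∨ ∃ t, l = [t] ∧ t.size = 4 ∧ t.count = 4 := by
  cases l with
  | nil => simp at h
  | cons t l =>
    have := t.size_pos
    rw [orderSum_cons] at h
    rcases (by omega : t.size = 1 ∨ t.size = 2 ∨ t.size = 3 ∨ t.size = 4) with hs | hs | hs | hs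
    · have := countProd_cons_le (l := l) (m := 3) (b := 3) hs (by omega) (by decide)
        (by decide) (by decide)
      omega
    · have := countProd_cons_le (l := l) (m := 2) (b := 3) hs (by omega) (by decide)
        (by decide) (by decide)
      omega
    · have := countProd_cons_le (l := l) (m := 1) (b := 3) hs (by omega) (by decide)
        (by decide) (by decide)
      omega
    · rw [eq_nil_of_orderSum (l := l) (by omega), countProd_cons, countProd_nil]
      rcases iso_of_size_four t hs with h' | ⟨h', -⟩
      · omega
      · exact Or.inr ⟨t, rfl, hs, h'⟩

theorem countProd_of_orderSum_five (l : List RTree) (h : orderSum l = 5) :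
    countProd l ≤ 4 ∨ ∃ t, l = [t] ∧ t.size = 5 ∧ t.count = 5 := by
  cases l with
  | nil => simp at h
  | cons t l =>
    have := t.size_pos
    rw [orderSum_cons] at h
    rcases (by omega : t.size = 1 ∨ t.size = 2 ∨ t.size = 3 ∨ t.size = 4 ∨ t.size = 5) with
      hs | hs | hs | hs | hs
    · have := countProd_cons_le (l := l) (m := 4) (b := 4) hs (by omega) (by decide)
        (by decide) (by decide)
      omega
    · have := countProd_cons_le (l := l) (m := 3) (b := 4) hs (by omega) (by decide)
        (by decide) (by decide)
      omega
    · have := countProd_cons_le (l := l) (m := 2) (b := 4) hs (by omega) (by decide)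
        (by decide) (by decide)
      omega
    · have := countProd_cons_le (l := l) (m := 1) (b := 4) hs (by omega) (by decide)
        (by decide) (by decide)
      omega
    · rw [eq_nil_of_orderSum (l := l) (by omega), countProd_cons, countProd_nil]
      rcases iso_of_size_five t hs with h' | ⟨h', -⟩
      · omega
      · exact Or.inr ⟨t, rfl, hs, h'⟩

theorem countProd_of_orderSum_six (l : List RTree) (h : orderSum l = 6) :
    countProd l = 9 ∨ countProd l ≤ 6 := by
  cases l with
  | nil => simp at h
  | cons t l =>
    have := t.size_pos
    rw [orderSum_cons] at h
    rcases (by omega : t.size = 1 ∨ t.size = 2 ∨ t.size = 3 ∨ t.size = 4 ∨ t.size = 5 ∨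
      t.size = 6) with hs | hs | hs | hs | hs | hs
    · have := countProd_cons_le (l := l) (m := 5) (b := 6) hs (by omega) (by decide)
        (by decide) (by decide)
      omega
    · have := countProd_cons_le (l := l) (m := 4) (b := 6) hs (by omega) (by decide)
        (by decide) (by decide)
      omega
    · have := countProd_of_orderSum_three l (by omega)
      rw [countProd_cons, (iso_of_size_three t hs).2]
      omega
    · have := countProd_cons_le (l := l) (m := 2) (b := 6) hs (by omega) (by decide)
        (by decide) (by decide)
      omega
    · have := countProd_cons_le (l := l) (m := 1) (b := 6) hs (by omega) (by decide)
        (by decide) (by decide)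
      omega
    · have := countProd_cons_le (l := l) (m := 0) (b := 6) hs (by omega) (by decide)
        (by decide) (by decide)
      omega

/-- At order 9 the weight threshold only yields counts up to 21, while the true second value is 20,
so the first component of the list is examined by its order. -/
theorem countProd_of_orderSum_nine (l : List RTree) (h : orderSum l = 9) :
    countProd l = 27 ∨ countProd l ≤ 19 ∨ ∃ s t, (l = [s, t] ∨ l = [t, s]) ∧
      (s.size = 4 ∧ s.count = 4) ∧ t.size = 5 ∧ t.count = 5 := by
  cases l with
  | nil => simp at h
  | cons t l =>
    have := t.size_pos
    rw [orderSum_cons] at h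
    rcases (by omega : t.size = 1 ∨ t.size = 2 ∨ t.size = 3 ∨ t.size = 4 ∨ t.size = 5 ∨
      t.size = 6 ∨ t.size = 7 ∨ t.size = 8 ∨ t.size = 9) with
      hs | hs | hs | hs | hs | hs | hs | hs | hs
    · have := countProd_cons_le (l := l) (m := 8) (b := 19) hs (by omega) (by decide)
        (by decide) (by decide)
      omega
    · have := countProd_cons_le (l := l) (m := 7) (b := 19) hs (by omega) (by decide)
        (by decide) (by decide)
      omega
    · have := countProd_of_orderSum_six l (by omega)
      rw [countProd_cons, (iso_of_size_three t hs).2]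
      omega
    · have h5 : countProd l ≤ 5 := by
        have := countProd_le l (by omega)
        rwa [show orderSum l = 5 by omega] at this
      rcases iso_of_size_four t hs with h' | ⟨h', -⟩
      · have := Nat.mul_le_mul h' h5
        rw [countProd_cons]
        omega
      · rcases countProd_of_orderSum_five l (by omega) with hl | ⟨s, rfl, hs', hc⟩
        · rw [countProd_cons, h']
          omega
        · exact Or.inr (Or.inr ⟨t, s, Or.inl rfl, ⟨hs, h'⟩, hs', hc⟩)
    · have h4 : countProd l ≤ 4 := by
        have := countProd_le l (by omega)
        rwa [show orderSum l = 4 by omega] at this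
      rcases iso_of_size_five t hs with h' | ⟨h', -⟩
      · have := Nat.mul_le_mul h' h4
        rw [countProd_cons]
        omega
      · rcases countProd_of_orderSum_four l (by omega) with hl | ⟨s, rfl, hs', hc⟩
        · rw [countProd_cons, h']
          omega
        · exact Or.inr (Or.inr ⟨s, t, Or.inr rfl, ⟨hs', hc⟩, hs, h'⟩)
    · have := countProd_cons_le (l := l) (m := 3) (b := 19) hs (by omega) (by decide)
        (by decide) (by decide)
      omega
    · have := countProd_cons_le (l := l) (m := 2) (b := 19) hs (by omega) (by decide)
        (by decide) (by decide)
      omega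
    · have := countProd_cons_le (l := l) (m := 1) (b := 19) hs (by omega) (by decide)
        (by decide) (by decide)
      omega
    · have := countProd_cons_le (l := l) (m := 0) (b := 19) hs (by omega) (by decide)
        (by decide) (by decide)
      omega

/-! ### Splitting off the paths of order three -/

/-- Paths of order 3 have weight 1 and may occur in any number; they are removed before weights are
compared. -/
theorem exists_decomposition (l : List RTree) : ∃ k q, (∀ t ∈ q, t.size ≠ 3) ∧
    orderSum l = 3 * k + orderSum q ∧ countProd l = 3 ^ k * countProd q ∧
    Nonempty (forestGraph l ≃g disjointCopies k pathP3 ⊕g forestGraph q) := by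
  set p := l.filter fun t => t.size == 3
  set q := l.filter fun t => !(t.size == 3)
  have hp : ∀ t ∈ p, t.size = 3 := fun t ht => by simpa using (List.mem_filter.1 ht).2
  have hperm : (p ++ q).Perm l := List.filter_append_perm _ l
  obtain ⟨h1, h2⟩ := of_forall_size_eq_three hp
  refine ⟨p.length, q, fun t ht => by simpa using (List.mem_filter.1 ht).2, ?_, ?_, ?_⟩
  · rw [← h1, orderSum, ← (hperm.map _).sum_eq, List.map_append, List.sum_append]; rfl
  · rw [← h2, countProd, ← (hperm.map _).prod_eq, List.map_append, List.prod_append]; rfl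
  · obtain ⟨e⟩ := nonempty_iso_of_perm hperm.symm
    obtain ⟨f⟩ := nonempty_iso_append p q
    obtain ⟨g⟩ := nonempty_iso_disjointCopies fun t ht => (iso_of_size_three t (hp t ht)).1
    exact ⟨(Iso.sumCongr g Iso.refl).comp (f.comp e)⟩

def forestGraphSingleton (t : RTree) : forestGraph [t] ≃g t.graph :=
  (@sumEmptyIso Empty t.V _ (forestGraph []) t.graph).comp Iso.sumComm

/-! ### The values of the bounds -/

theorem forestMax_three_mul {k : ℕ} (hk : 0 < k) : forestMax (3 * k) = 3 ^ k := by
  rw [forestMax, if_pos (by omega), show 3 * k / 3 = k by omega]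

theorem forestMax_add_four (k : ℕ) : forestMax (3 * k + 4) = 4 * 3 ^ k := by
  rw [forestMax, if_neg (by omega), if_pos (by omega), show (3 * k + 4 - 4) / 3 = k by omega]

theorem forestMax_add_eight (k : ℕ) : forestMax (3 * k + 8) = 16 * 3 ^ k := by
  rw [forestMax, if_neg (by omega), if_neg (by omega), if_neg (by omega), if_pos (by omega),
    show (3 * k + 8 - 8) / 3 = k by omega]
  norm_num

theorem forestSecond_add_seven (k : ℕ) : forestSecond (3 * k + 7) = 11 * 3 ^ k := by
  rw [forestSecond, if_neg (by omega), if_neg (by omega), if_neg (by omega), if_pos (by omega),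
    show (3 * k + 7 - 7) / 3 = k by omega]

theorem forestSecond_add_eight (k : ℕ) : forestSecond (3 * k + 8) = 15 * 3 ^ k := by
  rw [forestSecond, if_neg (by omega), if_neg (by omega), if_neg (by omega), if_neg (by omega),
    if_pos (by omega), show (3 * k + 8 - 8) / 3 = k by omega]

theorem forestSecond_add_twelve (k : ℕ) : forestSecond (3 * k + 12) = 64 * 3 ^ k := by
  rw [forestSecond, if_neg (by omega), if_neg (by omega), if_neg (by omega), if_neg (by omega),
    if_neg (by omega), if_neg (by omega), if_pos (by omega),
    show (3 * k + 12 - 12) / 3 = k by omega]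
  norm_num

theorem forestSecond_of_isSecondExtremalForest {V : Type*} {n : ℕ} {F : SimpleGraph V}
    (hn : 7 ≤ n) (h : IsSecondExtremalForest n F) :
    numMaxDissociationSets F = forestSecond n := by
  rcases h with ⟨h, ⟨e⟩⟩ | ⟨h, ⟨⟨e⟩⟩ | ⟨⟨e⟩⟩⟩ | ⟨rfl, ⟨e⟩⟩ | ⟨h, h12, ⟨e⟩⟩
  · obtain ⟨k, rfl⟩ : ∃ k, n = 3 * k + 7 := ⟨(n - 7) / 3, by omega⟩
    rw [numMaxDissociationSets_congr e, numMaxDissociationSets_sum,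
      numMaxDissociationSets_disjointCopies, numMaxDissociationSets_pathP3,
      numMaxDissociationSets_treeTStar, forestSecond_add_seven, mul_comm,
      show (3 * k + 7 - 7) / 3 = k by omega]
    norm_num
  · obtain ⟨k, rfl⟩ : ∃ k, n = 3 * k + 8 := ⟨(n - 8) / 3, by omega⟩
    rw [numMaxDissociationSets_congr e, numMaxDissociationSets_sum,
      numMaxDissociationSets_disjointCopies, numMaxDissociationSets_pathP3,
      numMaxDissociationSets_treeTStar8, forestSecond_add_eight, mul_comm,
      show (3 * k + 8 - 8) / 3 = k by omega]
  · obtain ⟨k, rfl⟩ : ∃ k, n = 3 * k + 8 := ⟨(n - 8) / 3, by omega⟩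
    rw [numMaxDissociationSets_congr e, numMaxDissociationSets_sum,
      numMaxDissociationSets_disjointCopies, numMaxDissociationSets_pathP3,
      numMaxDissociationSets_starK, forestSecond_add_eight,
      show (3 * k + 8 - 5) / 3 = k + 1 by omega, show (starTree 4).count = 5 from rfl]
    ring
  · rw [numMaxDissociationSets_congr e, numMaxDissociationSets_sum,
      numMaxDissociationSets_starK, numMaxDissociationSets_starK]
    rfl
  · obtain ⟨k, rfl⟩ : ∃ k, n = 3 * k + 12 := ⟨(n - 12) / 3, by omega⟩
    rw [numMaxDissociationSets_congr e, numMaxDissociationSets_sum,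
      numMaxDissociationSets_disjointCopies, numMaxDissociationSets_disjointCopies,
      numMaxDissociationSets_pathP3, numMaxDissociationSets_starK, forestSecond_add_twelve,
      show (3 * k + 12 - 12) / 3 = k by omega, show (starTree 3).count = 4 from rfl]
    ring

/-! ### The bound for forests -/

theorem nonempty_iso_of_isLarge {t : RTree} (h : IsLarge t) :
    (t.size = 5 ∧ t.count = 5 ∧ Nonempty (t.graph ≃g starK 4)) ∨
    (t.size = 7 ∧ t.count = 11 ∧ Nonempty (t.graph ≃g treeTStar 7)) ∨
    (t.size = 8 ∧ t.count = 15 ∧ Nonempty (t.graph ≃g treeTStar8)) := by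
  rcases h with ⟨h1, h2⟩ | ⟨h1, h2⟩ | ⟨h1, h2⟩
  · exact Or.inl ⟨h1, h2, ((iso_of_size_five t h1).resolve_left (by omega)).2⟩
  · exact Or.inr (Or.inl ⟨h1, h2, ((iso_of_size_seven t h1).resolve_left (by omega)).2⟩)
  · exact Or.inr (Or.inr ⟨h1, h2, ((iso_of_size_eight t h1).resolve_left (by omega)).2⟩)

theorem lt_or_isSecondExtremalForest_of_nine (l : List RTree) (hn : orderSum l = 9)
    (h : countProd l < 27) :
    countProd l < 20 ∨ countProd l = 20 ∧ IsSecondExtremalForest 9 (forestGraph l) := by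
  rcases countProd_of_orderSum_nine l hn with hl | hl | ⟨s, t, hl, ⟨hs, hs'⟩, ht, ht'⟩
  · omega
  · omega
  · have hperm : l.Perm [s, t] := by
      rcases hl with rfl | rfl
      · exact List.Perm.refl _
      · exact List.Perm.swap _ _ _
    refine Or.inr ⟨?_, Or.inr (Or.inr (Or.inl ⟨rfl, ?_⟩))⟩
    · rw [countProd, (hperm.map _).prod_eq]
      simp [hs', ht']
    · obtain ⟨e⟩ := nonempty_iso_of_perm hperm
      obtain ⟨f⟩ := ((iso_of_size_four s hs).resolve_left (by omega)).2
      obtain ⟨g⟩ := ((iso_of_size_five t ht).resolve_left (by omega)).2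
      exact ⟨(Iso.sumCongr f (g.comp (forestGraphSingleton t))).comp e⟩

/-- The weights belonging to `forestSecond` are (64/81) ^ 3, 1331/2187 and 125/243 in the residue
classes 0, 1 and 2, all at least the threshold of `IsSmall`. Order 9 has a smaller one and is
excluded. -/
theorem lt_forestSecond_of_isSmall {l q : List RTree} {k : ℕ} (hn : 7 ≤ orderSum l)
    (h9 : orderSum l ≠ 9) (h1 : orderSum l = 3 * k + orderSum q)
    (h2 : countProd l = 3 ^ k * countProd q) (h : IsSmall q) :
    countProd l < forestSecond (orderSum l) := by
  have hl : 531441 * countProd l ^ 3 < 262144 * 3 ^ orderSum l := by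
    rw [h1, h2, mul_pow, pow_add, ← pow_mul, mul_comm k]
    have := Nat.mul_lt_mul_of_pos_left h (show 0 < 3 ^ (3 * k) by positivity)
    linarith
  generalize orderSum l = n at *
  generalize countProd l = c at *
  by_contra! hle
  have hcube := Nat.pow_le_pow_left hle 3
  rcases (by omega : n % 3 = 0 ∨ n % 3 = 1 ∨ n % 3 = 2) with h | h | h
  · obtain ⟨j, rfl⟩ : ∃ j, n = 3 * j + 12 := ⟨(n - 12) / 3, by omega⟩
    rw [forestSecond_add_twelve, mul_pow, ← pow_mul, mul_comm j] at hcube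
    rw [pow_add] at hl
    omega
  · obtain ⟨j, rfl⟩ : ∃ j, n = 3 * j + 7 := ⟨(n - 7) / 3, by omega⟩
    rw [forestSecond_add_seven, mul_pow, ← pow_mul, mul_comm j] at hcube
    rw [pow_add] at hl
    omega
  · obtain ⟨j, rfl⟩ : ∃ j, n = 3 * j + 8 := ⟨(n - 8) / 3, by omega⟩
    rw [forestSecond_add_eight, mul_pow, ← pow_mul, mul_comm j] at hcube
    rw [pow_add] at hl
    omega

theorem lt_or_isSecondExtremalForest (l : List RTree) (hn : 7 ≤ orderSum l)
    (h : countProd l < forestMax (orderSum l)) :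
    countProd l < forestSecond (orderSum l) ∨ countProd l = forestSecond (orderSum l) ∧
      IsSecondExtremalForest (orderSum l) (forestGraph l) := by
  by_cases h9 : orderSum l = 9
  · rw [h9] at h ⊢
    exact lt_or_isSecondExtremalForest_of_nine l h9 h
  obtain ⟨k, q, hq, h1, h2, ⟨e⟩⟩ := exists_decomposition l
  rcases isSmall_or q hq with ⟨hlen, h4⟩ | ⟨t, rfl, ht⟩ | hs
  · obtain ⟨h5, h6⟩ := of_forall_size_eq_four h4
    have hiso := nonempty_iso_disjointCopies (G := starK 3) fun t ht =>
      ((iso_of_size_four t (h4 t ht).1).resolve_left (by have := (h4 t ht).2; omega)).2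
    rw [h5] at h1
    rw [h6] at h2
    generalize q.length = j at *
    -- With no, one or two K_{1,3} the count equals `forestMax`, against the hypothesis; three are
    -- extremal for `forestSecond`.
    interval_cases j
    · rw [show orderSum l = 3 * k by omega, forestMax_three_mul (by omega)] at h
      omega
    · rw [show orderSum l = 3 * k + 4 by omega, forestMax_add_four] at h
      omega
    · rw [show orderSum l = 3 * k + 8 by omega, forestMax_add_eight] at h
      omega
    · have hs : orderSum l = 3 * k + 12 := by omega
      rw [hs, forestSecond_add_twelve]
      obtain ⟨f⟩ := hiso
      refine Or.inr ⟨by omega, Or.inr (Or.inr (Or.inr ⟨by omega, by omega, ?_⟩))⟩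
      rw [show (3 * k + 12 - 12) / 3 = k by omega]
      exact ⟨(Iso.sumCongr Iso.refl f).comp e⟩
  · rw [orderSum_cons, orderSum_nil] at h1
    rw [countProd_cons, countProd_nil] at h2
    have e' := (Iso.sumCongr (Iso.refl (G := disjointCopies k pathP3))
      (forestGraphSingleton t)).comp e
    rcases nonempty_iso_of_isLarge ht with ⟨h3, h4, ⟨f⟩⟩ | ⟨h3, h4, ⟨f⟩⟩ | ⟨h3, h4, ⟨f⟩⟩
    -- Order at least 7 forces a path next to K_{1,4}; together with one path it matches
    -- `treeTStar8` in order and count.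
    · obtain ⟨j, rfl⟩ : ∃ j, k = j + 1 := ⟨k - 1, by omega⟩
      have hs : orderSum l = 3 * j + 8 := by omega
      rw [hs, forestSecond_add_eight]
      refine Or.inr ⟨by rw [h2, h4]; ring, Or.inr (Or.inl ⟨by omega, Or.inr ?_⟩)⟩
      rw [show (3 * j + 8 - 5) / 3 = j + 1 by omega]
      exact ⟨(Iso.sumCongr Iso.refl f).comp e'⟩
    · have hs : orderSum l = 3 * k + 7 := by omega
      rw [hs, forestSecond_add_seven]
      refine Or.inr ⟨by rw [h2, h4]; ring, Or.inl ⟨by omega, ?_⟩⟩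
      rw [show (3 * k + 7 - 7) / 3 = k by omega]
      exact ⟨(Iso.sumCongr Iso.refl f).comp e'⟩
    · have hs : orderSum l = 3 * k + 8 := by omega
      rw [hs, forestSecond_add_eight]
      refine Or.inr ⟨by rw [h2, h4]; ring, Or.inr (Or.inl ⟨by omega, Or.inl ?_⟩)⟩
      rw [show (3 * k + 8 - 8) / 3 = k by omega]
      exact ⟨(Iso.sumCongr Iso.refl f).comp e'⟩
  · exact Or.inl (lt_forestSecond_of_isSmall hn h9 h1 h2 hs)

theorem IsSecondExtremalForest.of_iso {V W : Type*} {n : ℕ} {F : SimpleGraph V}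
    {G : SimpleGraph W} (e : F ≃g G) (h : IsSecondExtremalForest n G) :
    IsSecondExtremalForest n F := by
  rcases h with ⟨h, ⟨f⟩⟩ | ⟨h, ⟨⟨f⟩⟩ | ⟨⟨f⟩⟩⟩ | ⟨h, ⟨f⟩⟩ | ⟨h, h12, ⟨f⟩⟩
  · exact Or.inl ⟨h, ⟨f.comp e⟩⟩
  · exact Or.inr (Or.inl ⟨h, Or.inl ⟨f.comp e⟩⟩)
  · exact Or.inr (Or.inl ⟨h, Or.inr ⟨f.comp e⟩⟩)
  · exact Or.inr (Or.inr (Or.inl ⟨h, ⟨f.comp e⟩⟩))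
  · exact Or.inr (Or.inr (Or.inr ⟨h, h12, ⟨f.comp e⟩⟩))

theorem numMaxDissociationSets_forest {n : ℕ} {V : Type*} [Fintype V] (F : SimpleGraph V)
    (hn : 4 ≤ n) (hV : Fintype.card V = n) (hF : F.IsAcyclic)
    (h : numMaxDissociationSets F < forestMax n) :
    numMaxDissociationSets F ≤ forestSecond n ∧
      (7 ≤ n → (numMaxDissociationSets F = forestSecond n ↔ IsSecondExtremalForest n F)) := by
  obtain ⟨l, ⟨e⟩⟩ := exists_forest F hF
  have hs : orderSum l = n := by
    rw [orderSum, ← card_forestV, ← hV]; exact Fintype.card_congr e.toEquiv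
  have hc : numMaxDissociationSets F = countProd l := by
    rw [← numMaxDissociationSets_congr e, numMaxDissociationSets_forestGraph, countProd]
  rcases Nat.lt_or_ge n 7 with h7 | h7
  · refine ⟨?_, fun h => by omega⟩
    rw [hc] at h ⊢
    -- For orders 4 and 5 the second value is one less than the maximum; only order 6 has a gap,
    -- from 9 to 6.
    interval_cases n
    · exact Nat.le_of_lt_succ h
    · exact Nat.le_of_lt_succ h
    · have h' : countProd l < 9 := h
      have := countProd_of_orderSum_six l hs
      change _ ≤ 6
      omega
  · subst hs
    rw [hc] at h
    rcases lt_or_isSecondExtremalForest l h7 h with h' | ⟨h', h''⟩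
    · rw [← hc] at h'
      exact ⟨h'.le, fun _ => ⟨fun h => absurd h h'.ne,
        forestSecond_of_isSecondExtremalForest h7⟩⟩
    · rw [← hc] at h'
      exact ⟨h'.le, fun _ => ⟨fun _ => IsSecondExtremalForest.of_iso e.symm h'', fun _ => h'⟩⟩

end Dissociation

theorem theorem2 :
    (∀ (n : ℕ) (V : Type*) [Fintype V] (T : SimpleGraph V),
      4 ≤ n → Fintype.card V = n → T.IsTree →
        (numMaxDissociationSets T : ℝ) ≤ treeBound n ∧
        ((numMaxDissociationSets T : ℝ) = treeBound n ↔
          n % 3 = 1 ∧ Nonempty (T ≃g treeTStar n))) ∧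
    (∀ (n : ℕ) (V : Type*) [Fintype V] (F : SimpleGraph V),
      4 ≤ n → Fintype.card V = n → F.IsAcyclic →
        numMaxDissociationSets F < forestMax n →
          numMaxDissociationSets F ≤ forestSecond n ∧
          (7 ≤ n →
            (numMaxDissociationSets F = forestSecond n ↔ IsSecondExtremalForest n F))) :=
  ⟨fun _ _ _ T hn hV hT => Dissociation.numMaxDissociationSets_tree T hn hV hT,
    fun _ _ _ F hn hV hF h => Dissociation.numMaxDissociationSets_forest F hn hV hF h⟩
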